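/- **Proposition (Closed curves).** Let $\Gamma$ be a closed curve in the plane with a $C^3$ unit speed parameterization $\gamma:\mathbb R\to\mathbb R^2$ of minimal period $L$, curvature $\kappa$ and turning number $\xi\in\mathbb Z$. Assume that $\Gamma$ is non-degenerate, i.e. its vertices (the points $\gamma(s)$ with $\kappa'(s)=0$) are isolated. Let $\sigma_\gamma=(\kappa,\kappa')$ be the signature map and $S=\sigma_\gamma(\mathbb R)$ the signature. A point of a planar set is called simple if it has an open neighbourhood whose intersection with the set is homeomorphic to $\mathbb R$ or to a half-open interval, and a self-intersection point otherwise. Assume that the set $Q$ of self-intersection points of $S$ is finite and non-empty. The signature quiver has vertex set $Q$; its edges $S_1,\dots,S_N$ are the connected components of $S\setminus Q$. Every connected component of $\sigma_\gamma^{-1}(S_i)$ is an open interval $(a,b)$; the edge $S_i$ goes from $\sigma_\gamma(a)$ to $\sigma_\gamma(b)$, and its weight is $\omega_i=\int_a^b\kappa(s)\,ds$ (these do not depend on the chosen component). Words in the edges in which each edge ends where the next one begins are paths; a path is closed if moreover its last edge ends where its first edge begins. A word is periodic if it is of the form $u^k$ with $k>1$. Let $W=S_{i_1}\cdots S_{i_k}=w^m$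 be a closed path (it need not contain all edges), where $w$ is not periodic, $m>1$ and $\gcd(m,\xi)=1$, and let $\tilde\mu_i$ be the number of times $S_i$ occurs in $W$. For each $r$ choose a connected component $(a_r,b_r)$ of $\sigma_\gamma^{-1}(S_{i_r})$, put $c_r=\sum_{j\le r}(b_j-a_j)$, let $\kappa_W(s)=\kappa(s+a_r-c_{r-1})$ for $s\in[c_{r-1},c_r)$, and extend $\kappa_W$ to $\mathbb R$ with period $L_W=c_k$. Let $\Gamma_W$ be the curve parameterized by $$\gamma_W(s)=\Big(\int_0^s\cos\eta(\tau)\,d\tau,\ \int_0^s\sin\eta(\tau)\,d\tau\Big),\qquad \eta(s)=\int_0^s\kappa_W(\tau)\,d\tau .$$ If $\sum_{i=1}^N\tilde\mu_i\omega_i=2\pi\xi$, then: 1. $\gamma_W$ is a $C^3$ unit speed parameterization, with curvature $\kappa_W$ and minimal period $L_W$, of a closed curve $\Gamma_W$; 2. the turning number of $\Gamma_W$ (over $[0,L_W]$) is $\xi$; 3. the symmetry index of $\Gamma_W$ is $m$: there are exactly $m$ elements $g\in SE(2)$ for which there is $c\in\mathbb R$ with $g\cdot\gamma_W(s)=\gamma_W(s+c)$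 for all $s$; 4. the signature index of $\Gamma_W$ is $\min\{\tilde\mu_i : S_i \text{ occurs in } W\}$: this is the minimum, over the points $\zeta$ of the signature of $\Gamma_W$, of $\#\{s\in[0,L_W) : \sigma_{\gamma_W}(s)=\zeta\}$; 5. if $\Gamma_W$ is simple (all its points are simple), then the indices of the oriented set $\Gamma_W$ have the same values: exactly $m$ elements $g\in SE(2)$ satisfy $g\cdot\Gamma_W=\Gamma_W$ as oriented curves, and $\min_{p\in\Gamma_W}\#\sigma_{\Gamma_W}^{-1}(\sigma_{\Gamma_W}(p))=\min\{\tilde\mu_i : S_i\text{ occurs in }W\}$, where $\sigma_{\Gamma_W}(\gamma_W(s))=\sigma_{\gamma_W}(s)$. -/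

import Mathlib

open Set Topology

noncomputable section

namespace SigCurve

/-! The Euclidean plane is `ℂ`; a curve is given by a parameterization `γ : ℝ → ℂ`,
and the signature lives in `ℝ × ℝ`. -/

/-- A point `p` of a planar set `Γ` is simple if some open set containing `p` meets `Γ` in a set
homeomorphic to `ℝ` or to a half-open interval. -/
def IsSimplePoint {X : Type*} [TopologicalSpace X] (Γ : Set X) (p : X) : Prop :=
  ∃ U : Set X, IsOpen U ∧ p ∈ U ∧
    (Nonempty (↥(Γ ∩ U) ≃ₜ ℝ) ∨ Nonempty (↥(Γ ∩ U) ≃ₜ ↥(Ico (0 : ℝ) 1)))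

/-- The set of self-intersection points of `Γ`: the points of `Γ` that are not simple. -/
def selfIntersections {X : Type*} [TopologicalSpace X] (Γ : Set X) : Set X :=
  {p | p ∈ Γ ∧ ¬ IsSimplePoint Γ p}

/-- `Γ` is simple if all its points are simple. -/
def IsSimple {X : Type*} [TopologicalSpace X] (Γ : Set X) : Prop :=
  ∀ p ∈ Γ, IsSimplePoint Γ p

/-- `γ` is a unit speed `C³` parameterization, with minimal period `L`, of a closed curve. -/
structure IsClosedCurve (γ : ℝ → ℂ) (L : ℝ) : Prop where
  contDiff : ContDiff ℝ 3 γ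
  unit_speed : ∀ s, ‖deriv γ s‖ = 1
  minimal_period : IsLeast {p : ℝ | 0 < p ∧ Function.Periodic γ p} L

/-- The signed Euclidean curvature `det (γ', γ'') / |γ'|³`. -/
def curvature (γ : ℝ → ℂ) (t : ℝ) : ℝ :=
  ((deriv γ t).re * (deriv (deriv γ) t).im - (deriv γ t).im * (deriv (deriv γ) t).re)
    / ‖deriv γ t‖ ^ 3

/-- The derivative of the curvature with respect to arc-length. -/
def curvatureDot (γ : ℝ → ℂ) (t : ℝ) : ℝ :=
  deriv (curvature γ) t / ‖deriv γ t‖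

/-- The parameterized signature map `σ_γ = (κ, κ̇)`. -/
def signatureMap (γ : ℝ → ℂ) (t : ℝ) : ℝ × ℝ := (curvature γ t, curvatureDot γ t)

/-- The set of vertices of the curve (points at which `κ̇` vanishes). -/
def curveVertices (γ : ℝ → ℂ) : Set ℂ := γ '' {t | curvatureDot γ t = 0}

/-- A curve is non-degenerate if all its vertices are isolated. -/
def IsNondegenerate (γ : ℝ → ℂ) : Prop :=
  ∀ p ∈ curveVertices γ, ∃ U ∈ 𝓝 p, curveVertices γ ∩ U = {p}

/-- `ξ` is the turning number of `γ` over `[0, L]`: a continuous angle function of the tangent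
increases by `2πξ`. -/
def HasTurningNumber (γ : ℝ → ℂ) (L : ℝ) (ξ : ℤ) : Prop :=
  ∃ θ : ℝ → ℝ, Continuous θ ∧
    (∀ s, deriv γ s = (‖deriv γ s‖ : ℂ) * Complex.exp ((θ s : ℂ) * Complex.I)) ∧
    θ L - θ 0 = 2 * Real.pi * ξ

/-! ### Symmetry and signature indices

An element of `SE(2)` is a pair `(u, v)` acting by `z ↦ u z + v`, where `|u| = 1`. -/

/-- The action of `SE(2)` on the plane. -/
def se2Act (g : Circle × ℂ) (z : ℂ) : ℂ := (g.1 : ℂ) * z + g.2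

/-- The symmetry index of the oriented set `Γ = range γ` (used for simple `Γ`): the number of
`g ∈ SE(2)` with `g · Γ = Γ`, as sets and as oriented curves. The orientation is recorded by the
set of pairs (point, tangent vector), on which `g` acts by `(p, v) ↦ (g p, u v)`. -/
def symIndex (γ : ℝ → ℂ) : ℕ∞ :=
  {g : Circle × ℂ |
    se2Act g '' range γ = range γ ∧
    (fun x : ℂ × ℂ => (se2Act g x.1, (g.1 : ℂ) * x.2)) '' range (fun s => (γ s, deriv γ s))
      = range (fun s => (γ s, deriv γ s))}.encard

/-- The symmetry index of a unit speed parameterized curve, simple or not: the number of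
`g ∈ SE(2)` that carry the parameterized curve to itself up to a shift of the parameter. -/
def paramSymIndex (γ : ℝ → ℂ) : ℕ∞ :=
  {g : Circle × ℂ | ∃ c : ℝ, ∀ s, se2Act g (γ s) = γ (s + c)}.encard

/-- The signature index of `Γ = range γ` (used for simple `Γ`): the minimum over the points
`p = γ t` of `Γ` of the number of points of `Γ` with the same value of the signature map. -/
def sigIndex (γ : ℝ → ℂ) : ℕ∞ :=
  ⨅ t : ℝ, (γ '' {u | signatureMap γ u = signatureMap γ t}).encard

/-- The signature index of a parameterized closed curve of period `L`, simple or not: the minimum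
over the signature points `ζ` of the number of parameters in `[0, L)` that are mapped to `ζ`. -/
def paramSigIndex (γ : ℝ → ℂ) (L : ℝ) : ℕ∞ :=
  ⨅ ζ ∈ range (signatureMap γ), {u | u ∈ Ico 0 L ∧ signatureMap γ u = ζ}.encard

/-! ### The quiver of a parameterized closed curve `σ` -/

/-- An edge of the quiver of `S`: a connected component of `S` with its self-intersection points
removed. -/
def QuiverEdge (S : Set (ℝ × ℝ)) : Type :=
  {E : Set (ℝ × ℝ) // ∃ ζ ∈ S \ selfIntersections S,
    E = connectedComponentIn (S \ selfIntersections S) ζ}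

/-- `(a, b)` is one of the parameter intervals that trace the edge `E`, that is, a connected
component of `σ⁻¹(E)`. -/
def IsEdgeArc (σ : ℝ → ℝ × ℝ) (E : QuiverEdge (range σ)) (a b : ℝ) : Prop :=
  ∃ t ∈ σ ⁻¹' E.1, connectedComponentIn (σ ⁻¹' E.1) t = Ioo a b

/-- `q` is the beginning vertex of the edge `E`. -/
def IsBeginning (σ : ℝ → ℝ × ℝ) (E : QuiverEdge (range σ)) (q : ℝ × ℝ) : Prop :=
  ∃ a b, IsEdgeArc σ E a b ∧ σ a = q

/-- `q` is the ending vertex of the edge `E`. -/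
def IsEnding (σ : ℝ → ℝ × ℝ) (E : QuiverEdge (range σ)) (q : ℝ × ℝ) : Prop :=
  ∃ a b, IsEdgeArc σ E a b ∧ σ b = q

/-- The edge `F` may follow the edge `E`. -/
def Follows (σ : ℝ → ℝ × ℝ) (E F : QuiverEdge (range σ)) : Prop :=
  ∃ q, IsEnding σ E q ∧ IsBeginning σ F q

/-- A closed path: each edge is followed by the next one, and the last edge by the first one. -/
def IsClosedPath (σ : ℝ → ℝ × ℝ) (W : List (QuiverEdge (range σ))) : Prop :=
  W.IsChain (Follows σ) ∧ ∃ h : W ≠ [], Follows σ (W.getLast h) (W.head h)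

/-- The word `w ^ m`. -/
def wordPow {α : Type*} (w : List α) (m : ℕ) : List α := (List.replicate m w).flatten

/-- A word is periodic if it is a power `u ^ k` with `k > 1`. -/
def IsPeriodicWord {α : Type*} (w : List α) : Prop :=
  ∃ (u : List α) (k : ℕ), 1 < k ∧ w = wordPow u k

/-- The multiplicity of an edge in a word. -/
def multiplicity {α : Type*} (W : List α) (E : α) : ℕ :=
  letI := Classical.decEq α
  W.count E

/-- `x` is the weight of the edge `E` of the signature quiver of `γ`: the integral of the curvature
over one of the parameter intervals that trace `E`. -/
def IsWeight (γ : ℝ → ℂ) (E : QuiverEdge (range (signatureMap γ))) (x : ℝ) : Prop :=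
  ∃ a b, IsEdgeArc (signatureMap γ) E a b ∧ x = ∫ s in a..b, curvature γ s

/-! ### The curve induced by a path -/

/-- The total length of a list of intervals `(a_r, b_r)`. -/
def totalLength (I : List (ℝ × ℝ)) : ℝ := (I.map fun p => p.2 - p.1).sum

/-- The concatenation of the restrictions of `κ` to the intervals `(a_r, b_r)` of the list: with
`c_r = ∑_{j ≤ r} (b_j - a_j)`, its value at `s ∈ [c_{r-1}, c_r)` is `κ (s + a_r - c_{r-1})`. -/
def concatenate (κ : ℝ → ℝ) : List (ℝ × ℝ) → ℝ → ℝ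
  | [], _ => 0
  | p :: I, s => if s < p.2 - p.1 then κ (s + p.1) else concatenate κ I (s - (p.2 - p.1))

/-- The reshuffled curvature `κ_W`: the concatenation, extended from `[0, c_k)` to `ℝ` with
period `c_k`. -/
def reshuffle (κ : ℝ → ℝ) (I : List (ℝ × ℝ)) (s : ℝ) : ℝ :=
  concatenate κ I (s - totalLength I * ⌊s / totalLength I⌋)

/-- The unit speed curve with curvature function `κ`, starting at `0` with tangent vector `1`:
`γ(s) = ∫₀ˢ (cos η, sin η)`, where `η(s) = ∫₀ˢ κ`. -/
def curveOfCurvature (κ : ℝ → ℝ) (s : ℝ) : ℂ :=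
  ∫ τ in (0 : ℝ)..s, Complex.exp (((∫ x in (0 : ℝ)..τ, κ x : ℝ) : ℂ) * Complex.I)

end SigCurve

end

open SigCurve

/-!
At a simple point of the signature, the signature map determines the parameter up to a translation:
a local reparametrization `φ` that preserves `κ` and `κ̇` has derivative one wherever `κ̇` does not
vanish. Hence all arcs that trace a given edge are translates of each other, and consecutive arcs
of a closed path fit together to a `C¹` function `κ_W`. The parameters at which the pair
`(κ_W, κ̇_W)` passes through a self-intersection point of the signature are the breakpoints `c_r`,
so the periods of `κ_W` correspond to those of the bi-infinite word that repeats `W`. As `w` is not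
periodic, they are the multiples of `ℓ = L_W / m`.

The tangent turns by `2πξ / m` over `ℓ`, that is, by a primitive `m`-th root of unity, since `m`
and `ξ` are coprime. Since this rotation is not trivial, the curve closes up after exactly `m`
steps, and its symmetries are the `m` rotations obtained from shifts by multiples of `ℓ`. The
fibres of the signature map over `[0, L_W)` count the occurrences of edges in `W`. On a simple
curve, the point determines the parameter up to a period, so that the indices of the oriented set
agree with those of the parameterization.
-/

namespace SigCurve

section LocalReparametrization

variable {X : Type*} [TopologicalSpace X] {Γ : Set X} {p : X}

lemma IsSimplePoint.exists_continuousOn_injOn (hp : IsSimplePoint Γ p) :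
    ∃ U : Set X, IsOpen U ∧ p ∈ U ∧ ∃ H : X → ℝ, ContinuousOn H (Γ ∩ U) ∧ InjOn H (Γ ∩ U) := by
  obtain ⟨U, hU, hpU, hhomeo⟩ := hp
  obtain ⟨h, hcont, hinj⟩ : ∃ h : ↥(Γ ∩ U) → ℝ, Continuous h ∧ Function.Injective h := by
    rcases hhomeo with ⟨⟨e⟩⟩ | ⟨⟨e⟩⟩
    · exact ⟨e, e.continuous, e.injective⟩
    · exact ⟨fun x => (e x : ℝ), continuous_subtype_val.comp e.continuous,
        Subtype.val_injective.comp e.injective⟩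
  have hrestrict : (Γ ∩ U).domRestrict (Function.extend Subtype.val h 0) = h :=
    funext fun x => Subtype.val_injective.extend_apply h 0 x
  refine ⟨U, hU, hpU, Function.extend Subtype.val h 0, ?_, ?_⟩
  · rwa [continuousOn_iff_continuous_domRestrict, hrestrict]
  · rwa [injOn_iff_injective, hrestrict]

lemma image_mem_nhds_of_continuousOn_of_injOn {f : ℝ → ℝ} {t : ℝ} {U : Set ℝ} (hU : U ∈ 𝓝 t)
    (hf : ContinuousOn f U) (hinj : InjOn f U) : f '' U ∈ 𝓝 (f t) := by
  obtain ⟨δ, hδ, hδU⟩ := (nhds_basis_Icc_pos t).mem_iff.1 hU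
  have hle : t - δ ≤ t + δ := by linarith
  have hleft : t - δ ∈ Icc (t - δ) (t + δ) := left_mem_Icc.2 hle
  have hmid : t ∈ Icc (t - δ) (t + δ) := ⟨by linarith, by linarith⟩
  have hright : t + δ ∈ Icc (t - δ) (t + δ) := right_mem_Icc.2 hle
  refine Filter.mem_of_superset ?_ (image_mono hδU)
  rcases (hf.mono hδU).strictMonoOn_of_injOn_Icc' hle (hinj.mono hδU) with hmono | hanti
  · exact Filter.mem_of_superset
      (Icc_mem_nhds (hmono hleft hmid (by linarith)) (hmono hmid hright (by linarith)))
      (intermediate_value_Icc hle (hf.mono hδU))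
  · exact Filter.mem_of_superset
      (Icc_mem_nhds (hanti hmid hright (by linarith)) (hanti hleft hmid (by linarith)))
      (intermediate_value_Icc' hle (hf.mono hδU))

lemma IsSimplePoint.image_mem_nhdsWithin {β : ℝ → X} (hβ : Continuous β) (hβΓ : ∀ s, β s ∈ Γ)
    {t : ℝ} (hp : IsSimplePoint Γ (β t)) {U : Set ℝ} (hU : U ∈ 𝓝 t) (hinj : InjOn β U) :
    β '' U ∈ 𝓝[Γ] (β t) := by
  obtain ⟨V, hV, hpV, H, hHcont, hHinj⟩ := hp.exists_continuousOn_injOn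
  have hmaps : MapsTo β (U ∩ β ⁻¹' V) (Γ ∩ V) := fun s hs => ⟨hβΓ s, hs.2⟩
  have himage : H ∘ β '' (U ∩ β ⁻¹' V) ∈ 𝓝 (H (β t)) :=
    image_mem_nhds_of_continuousOn_of_injOn
      (Filter.inter_mem hU ((hV.preimage hβ).mem_nhds hpV))
      (hHcont.comp hβ.continuousOn hmaps) (hHinj.comp (hinj.mono inter_subset_left) hmaps)
  have hpre : Γ ∩ V ∩ H ⁻¹' (H ∘ β '' (U ∩ β ⁻¹' V)) ∈ 𝓝[Γ ∩ V] (β t) :=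
    Filter.inter_mem self_mem_nhdsWithin (hHcont (β t) ⟨hβΓ t, hpV⟩ himage)
  rw [nhdsWithin_inter_of_mem' (mem_nhdsWithin_of_mem_nhds (hV.mem_nhds hpV))] at hpre
  refine Filter.mem_of_superset hpre ?_
  rintro x ⟨hx, s, hs, hsx⟩
  exact ⟨s, hs.1, hHinj (hmaps hs) hx hsx⟩

lemma continuousOn_invFunOn_of_isCompact {Y : Type*} [TopologicalSpace Y] [Nonempty Y] [T2Space X]
    {β : Y → X} {K : Set Y} (hK : IsCompact K) (hβ : ContinuousOn β K) (hinj : InjOn β K) :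
    ContinuousOn (Function.invFunOn β K) (β '' K) := by
  have := isCompact_iff_compactSpace.1 hK
  have hemb : IsClosedEmbedding (K.domRestrict β) :=
    hβ.domRestrict.isClosedEmbedding (injOn_iff_injective.1 hinj)
  have hmem (x : β '' K) : Function.invFunOn β K x ∈ K := Function.invFunOn_mem x.2
  suffices h : Continuous fun x : β '' K => (⟨Function.invFunOn β K x, hmem x⟩ : K) from
    continuousOn_iff_continuous_domRestrict.2 (continuous_subtype_val.comp h)
  refine hemb.isEmbedding.continuous_iff.2 (continuous_subtype_val.congr fun x => ?_)
  exact (Function.invFunOn_eq x.2).symm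

lemma IsSimplePoint.exists_local_reparametrization [T2Space X] {T : Type*} [TopologicalSpace T]
    {α : T → X} {β : ℝ → X} (hα : Continuous α) (hαΓ : ∀ s, α s ∈ Γ) (hβ : Continuous β)
    (hβΓ : ∀ s, β s ∈ Γ) {t : T} {t' : ℝ} (hp : IsSimplePoint Γ (β t')) (htt' : α t = β t')
    {U : Set ℝ} (hU : U ∈ 𝓝 t') (hinj : InjOn β U) :
    ∃ φ : T → ℝ, φ t = t' ∧ (∀ᶠ s in 𝓝 t, ContinuousAt φ s) ∧
      ∀ᶠ s in 𝓝 t, φ s ∈ U ∧ β (φ s) = α s := by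
  obtain ⟨K, hK, hKU, hKcompact⟩ := local_compact_nhds hU
  have hcover : ∀ᶠ s in 𝓝 t, α s ∈ β '' K := by
    have himage := hp.image_mem_nhdsWithin hβ hβΓ hK (hinj.mono hKU)
    rw [← htt'] at himage
    exact tendsto_nhdsWithin_of_tendsto_nhds_of_eventually_within _ hα.continuousAt
      (Filter.Eventually.of_forall hαΓ) himage
  have hφ : ContinuousOn (Function.invFunOn β K ∘ α) (α ⁻¹' (β '' K)) :=
    (continuousOn_invFunOn_of_isCompact hKcompact hβ.continuousOn (hinj.mono hKU)).comp
      hα.continuousOn fun _ hs => hs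
  refine ⟨Function.invFunOn β K ∘ α, ?_, ?_, ?_⟩
  · rw [Function.comp_apply, htt']
    exact (hinj.mono hKU).leftInvOn_invFunOn (mem_of_mem_nhds hK)
  · exact (eventually_eventually_nhds.2 hcover).mono fun s hs => hφ.continuousAt hs
  · exact hcover.mono fun s hs => ⟨hKU (Function.invFunOn_mem hs), Function.invFunOn_eq hs⟩

end LocalReparametrization

lemma hasDerivAt_of_comp_eventuallyEq {f g φ : ℝ → ℝ} {s f' g' : ℝ} (hφ : ContinuousAt φ s)
    (hf : HasDerivAt f f' (φ s)) (hf' : f' ≠ 0) (hg : HasDerivAt g g' s)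
    (h : f ∘ φ =ᶠ[𝓝 s] g) : HasDerivAt φ (g' / f') s := by
  have hdslope : Filter.Tendsto (fun x => dslope f (φ s) (φ x)) (𝓝 s) (𝓝 f') := by
    have := (continuousAt_dslope_same.2 hf.differentiableAt).tendsto.comp hφ.tendsto
    rwa [dslope_same, hf.deriv] at this
  rw [hasDerivAt_iff_tendsto_slope] at hg ⊢
  refine (hg.div (hdslope.mono_left nhdsWithin_le_nhds) hf').congr' ?_
  filter_upwards [nhdsWithin_le_nhds h, nhdsWithin_le_nhds (hdslope.eventually_ne hf')]
    with x hx hne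
  have hslope := sub_smul_dslope f (φ s) (φ x)
  rw [show f (φ s) = g s from h.self_of_nhds, show f (φ x) = g x from hx, smul_eq_mul] at hslope
  rw [Pi.div_apply, div_eq_iff hne, slope_def_field, slope_def_field, ← hslope]
  ring

lemma eventually_eq_add_mul_of_hasDerivAt {φ : ℝ → ℝ} {t c : ℝ}
    (hcont : ∀ᶠ s in 𝓝 t, ContinuousAt φ s) (hderiv : ∀ᶠ s in 𝓝[≠] t, HasDerivAt φ c s) :
    ∀ᶠ s in 𝓝 t, φ s = φ t + c * (s - t) := by
  obtain ⟨ε, hε, hball⟩ := Metric.eventually_nhds_iff_ball.1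
    (hcont.and (eventually_nhdsWithin_iff.1 hderiv))
  rw [Real.ball_eq_Ioo] at hball
  have hincrement {x y : ℝ} (hx : t - ε < x) (hy : y < t + ε) (hxy : x < y) (ht : t ∉ Ioo x y) :
      φ y - φ x = c * (y - x) := by
    obtain ⟨z, -, hz⟩ := exists_hasDerivAt_eq_slope φ (fun _ => c) hxy
      (fun z hz => (hball z (Icc_subset_Ioo hx hy hz)).1.continuousWithinAt)
      (fun z hz => (hball z ⟨hx.trans hz.1, hz.2.trans hy⟩).2 fun hzt => ht (hzt ▸ hz))
    rw [hz, div_mul_cancel₀ _ (sub_ne_zero.2 hxy.ne')]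
  filter_upwards [Ioo_mem_nhds (sub_lt_self t hε) (lt_add_of_pos_right t hε)] with s hs
  rcases lt_trichotomy s t with hst | rfl | hts
  · linarith [hincrement hs.1 (by linarith) hst fun h => h.2.ne rfl]
  · ring
  · linarith [hincrement (by linarith) hs.2 hts fun h => h.1.ne rfl]

section DerivativePair

lemma mul_pos_of_isPreconnected {X : Type*} [TopologicalSpace X] {f : X → ℝ} {s : Set X}
    (hs : IsPreconnected s) (hf : ContinuousOn f s) (h0 : ∀ z ∈ s, f z ≠ 0) {x y : X}
    (hx : x ∈ s) (hy : y ∈ s) : 0 < f x * f y := by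
  by_contra! hneg
  obtain ⟨z, hz, hfz⟩ : (0 : ℝ) ∈ f '' s := by
    rcases mul_nonpos_iff.1 hneg with ⟨hfx, hfy⟩ | ⟨hfx, hfy⟩
    · exact hs.intermediate_value hy hx hf ⟨hfy, hfx⟩
    · exact hs.intermediate_value hx hy hf ⟨hfx, hfy⟩
  exact h0 z hz hfz

variable {f : ℝ → ℝ}

lemma deriv_mul_sub_pos (hf : ContDiff ℝ 1 f) {s : Set ℝ} (hs : s.OrdConnected)
    (h0 : ∀ z ∈ s, deriv f z ≠ 0) {x y w : ℝ} (hxy : x < y) (hsub : Ioo x y ⊆ s) (hw : w ∈ s) :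
    0 < deriv f w * (f y - f x) := by
  obtain ⟨z, hz, hslope⟩ := exists_deriv_eq_slope f hxy hf.continuous.continuousOn
    (hf.differentiable_one.differentiableOn)
  have hsign : 0 < deriv f w * deriv f z :=
    mul_pos_of_isPreconnected hs.isPreconnected hf.continuous_deriv_one.continuousOn h0 hw
      (hsub hz)
  rw [eq_div_iff (sub_ne_zero.2 hxy.ne')] at hslope
  rw [← hslope, ← mul_assoc]
  exact mul_pos hsign (sub_pos.2 hxy)

lemma injOn_prodMk_deriv (hf : ContDiff ℝ 1 f) {s : Set ℝ} (hs : s.OrdConnected) {t : ℝ}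
    (h0 : ∀ z ∈ s, z ≠ t → deriv f z ≠ 0) : InjOn (fun x => (f x, deriv f x)) s := by
  intro x hx y hy hxy
  by_contra! hne
  wlog hlt : x < y generalizing x y
  · exact this hy hx hxy.symm hne.symm (hne.symm.lt_of_le (not_lt.1 hlt))
  obtain ⟨hval, hder⟩ := Prod.mk.inj hxy
  have ht : t ∈ Ioo x y := by
    obtain ⟨z, hz, hz0⟩ := exists_deriv_eq_zero hlt hf.continuous.continuousOn hval
    have hzt : z = t := by
      by_contra hzt
      exact h0 z (hs.out hx hy (Ioo_subset_Icc_self hz)) hzt hz0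
    exact hzt ▸ hz
  have hleft : 0 < deriv f x * (f t - f x) :=
    deriv_mul_sub_pos hf ordConnected_Ico
      (fun z hz => h0 z (hs.out hx hy ⟨hz.1, (hz.2.trans ht.2).le⟩) hz.2.ne)
      ht.1 Ioo_subset_Ico_self (left_mem_Ico.2 ht.1)
  have hright : 0 < deriv f y * (f y - f t) :=
    deriv_mul_sub_pos hf ordConnected_Ioc
      (fun z hz => h0 z (hs.out hx hy ⟨(ht.1.trans hz.1).le, hz.2⟩) hz.1.ne')
      ht.2 Ioo_subset_Ioc_self (right_mem_Ioc.2 ht.2)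
  rw [hder, hval] at hleft
  linarith

lemma exists_mem_nhds_injOn_prodMk_deriv (hf : ContDiff ℝ 1 f) {t : ℝ}
    (h0 : ∀ᶠ s in 𝓝[≠] t, deriv f s ≠ 0) : ∃ U ∈ 𝓝 t, InjOn (fun x => (f x, deriv f x)) U := by
  obtain ⟨ε, hε, hball⟩ := Metric.eventually_nhds_iff_ball.1 (eventually_nhdsWithin_iff.1 h0)
  exact ⟨Metric.ball t ε, Metric.ball_mem_nhds t hε,
    injOn_prodMk_deriv hf (convex_ball t ε).ordConnected fun z hz hzt => hball z hz hzt⟩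

/-- The equations `f ∘ φ = f` and `f' ∘ φ = f'` for a local reparametrization `φ` force `φ' = 1`
wherever `f' ≠ 0`. -/
lemma eventually_prodMk_deriv_add_eq (hf : ContDiff ℝ 1 f)
    (h0 : ∀ t, ∀ᶠ s in 𝓝[≠] t, deriv f s ≠ 0) {t t' : ℝ}
    (hp : IsSimplePoint (range fun x => (f x, deriv f x)) (f t, deriv f t))
    (htt' : (f t, deriv f t) = (f t', deriv f t')) :
    ∀ᶠ s in 𝓝 t, (f (s + (t' - t)), deriv f (s + (t' - t))) = (f s, deriv f s) := by
  have hσ : Continuous fun x => (f x, deriv f x) := hf.continuous.prodMk hf.continuous_deriv_one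
  obtain ⟨U, hU, hinj⟩ := exists_mem_nhds_injOn_prodMk_deriv hf (h0 t')
  rw [htt'] at hp
  obtain ⟨φ, hφt, hφ, hcomp⟩ := hp.exists_local_reparametrization (α := fun x => (f x, deriv f x))
    (β := fun x => (f x, deriv f x)) hσ mem_range_self hσ mem_range_self htt' hU hinj
  have hvalue : ∀ᶠ s in 𝓝 t, f (φ s) = f s := hcomp.mono fun s hs => congrArg Prod.fst hs.2
  have hderiv : ∀ᶠ s in 𝓝[≠] t, HasDerivAt φ 1 s := by
    filter_upwards [h0 t, nhdsWithin_le_nhds hφ, nhdsWithin_le_nhds hcomp,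
      nhdsWithin_le_nhds (eventually_eventually_nhds.2 hvalue)] with s hs0 hφs hs hvalues
    have hslope : deriv f (φ s) = deriv f s := congrArg Prod.snd hs.2
    have hf' (x : ℝ) : HasDerivAt f (deriv f x) x := (hf.differentiable_one x).hasDerivAt
    have := hasDerivAt_of_comp_eventuallyEq hφs (hf' (φ s)) (hslope ▸ hs0) (hf' s) hvalues
    rwa [hslope, div_self hs0] at this
  filter_upwards [eventually_eq_add_mul_of_hasDerivAt hφ hderiv, hcomp] with s hs hcomps
  have hshift : s + (t' - t) = φ s := by rw [hs, hφt]; ring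
  rw [hshift]
  exact hcomps.2

end DerivativePair

section RigidMaps

lemma isOpen_setOf_isSimplePoint {X : Type*} [TopologicalSpace X] (Γ : Set X) :
    IsOpen {p | IsSimplePoint Γ p} := by
  rw [isOpen_iff_mem_nhds]
  rintro p ⟨U, hU, hp, hhomeo⟩
  exact Filter.mem_of_superset (hU.mem_nhds hp) fun q hq => ⟨U, hU, hq, hhomeo⟩

/-- A continuous locally injective plane curve whose parameter is determined up to translation near
every simple point of its image. Signature maps have this property, and the quiver of a curve
behaves well for every such map. -/
structure IsRigid (σ : ℝ → ℝ × ℝ) : Prop where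
  continuous : Continuous σ
  exists_injOn : ∀ t, ∃ U ∈ 𝓝 t, InjOn σ U
  eventually_add_eq : ∀ {t t' : ℝ}, IsSimplePoint (range σ) (σ t) → σ t = σ t' →
    ∀ᶠ x in 𝓝 t, σ (x + (t' - t)) = σ x

lemma isRigid_prodMk_deriv {f : ℝ → ℝ} (hf : ContDiff ℝ 1 f)
    (h0 : ∀ t, ∀ᶠ s in 𝓝[≠] t, deriv f s ≠ 0) : IsRigid fun x => (f x, deriv f x) where
  continuous := hf.continuous.prodMk hf.continuous_deriv_one
  exists_injOn t := exists_mem_nhds_injOn_prodMk_deriv hf (h0 t)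
  eventually_add_eq := eventually_prodMk_deriv_add_eq hf h0

variable {σ : ℝ → ℝ × ℝ}

lemma IsRigid.eqOn_add (h : IsRigid σ) {C : Set ℝ} (hC : IsPreconnected C)
    (hsimple : ∀ x ∈ C, IsSimplePoint (range σ) (σ x)) {t t' : ℝ} (ht : t ∈ C)
    (htt' : σ t = σ t') : EqOn (fun x => σ (x + (t' - t))) σ C := by
  set A : Set ℝ := {x | σ (x + (t' - t)) = σ x}
  have hclosed : IsClosed A :=
    isClosed_eq (h.continuous.comp (continuous_add_const _)) h.continuous
  have hinterior : A ∩ C ⊆ interior A := by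
    rintro x ⟨hxA, hxC⟩
    have hev := h.eventually_add_eq (hsimple x hxC) (t' := x + (t' - t)) hxA.symm
    rw [add_sub_cancel_left] at hev
    exact mem_interior_iff_mem_nhds.2 hev
  have htA : t ∈ A := by
    rw [mem_ofPred_eq, add_sub_cancel, htt']
  refine (hC.subset_of_closure_inter_subset isOpen_interior ⟨t, ht, hinterior ⟨htA, ht⟩⟩
    fun x hx => ?_).trans interior_subset
  exact hinterior ⟨closure_minimal interior_subset hclosed hx.1, hx.2⟩

end RigidMaps

section QuiverEdge

variable {S : Set (ℝ × ℝ)} {E F : QuiverEdge S} {q : ℝ × ℝ}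

lemma QuiverEdge.subset (E : QuiverEdge S) : E.1 ⊆ S \ selfIntersections S := by
  obtain ⟨ζ, -, hE⟩ := E.2
  exact hE ▸ connectedComponentIn_subset _ _

lemma QuiverEdge.isPreconnected (E : QuiverEdge S) : IsPreconnected E.1 := by
  obtain ⟨ζ, -, hE⟩ := E.2
  exact hE ▸ isPreconnected_connectedComponentIn

lemma QuiverEdge.eq_connectedComponentIn (hq : q ∈ E.1) :
    E.1 = connectedComponentIn (S \ selfIntersections S) q := by
  obtain ⟨ζ, -, hE⟩ := E.2
  rw [hE] at hq ⊢
  exact connectedComponentIn_eq hq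

lemma QuiverEdge.eq_of_mem (hE : q ∈ E.1) (hF : q ∈ F.1) : E = F :=
  Subtype.ext ((eq_connectedComponentIn hE).trans (eq_connectedComponentIn hF).symm)

lemma mem_sdiff_selfIntersections_iff :
    q ∈ S \ selfIntersections S ↔ q ∈ S ∧ IsSimplePoint S q := by
  simp +contextual [selfIntersections]

lemma QuiverEdge.isSimplePoint (hq : q ∈ E.1) : IsSimplePoint S q :=
  (mem_sdiff_selfIntersections_iff.1 (E.subset hq)).2

lemma QuiverEdge.subset_of_isPreconnected {T : Set (ℝ × ℝ)} (hT : IsPreconnected T) (hTS : T ⊆ S)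
    (hsimple : ∀ p ∈ T, IsSimplePoint S p) (hqT : q ∈ T) (hqE : q ∈ E.1) : T ⊆ E.1 := by
  rw [eq_connectedComponentIn hqE]
  exact hT.subset_connectedComponentIn hqT fun p hp =>
    mem_sdiff_selfIntersections_iff.2 ⟨hTS hp, hsimple p hp⟩

end QuiverEdge

section EdgeComponents

variable {σ : ℝ → ℝ × ℝ} {E : QuiverEdge (range σ)} {t t' : ℝ}

lemma QuiverEdge.mapsTo_of_isPreconnected (hσ : Continuous σ) {T : Set ℝ} (hT : IsPreconnected T)
    (hsimple : ∀ x ∈ T, IsSimplePoint (range σ) (σ x)) (htT : t ∈ T) (ht : σ t ∈ E.1) :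
    MapsTo σ T E.1 :=
  mapsTo_iff_image_subset.2 <| subset_of_isPreconnected (hT.image σ hσ.continuousOn)
    (image_subset_range σ T) (forall_mem_image.2 hsimple) (mem_image_of_mem σ htT) ht

lemma QuiverEdge.isOpen_preimage (hσ : Continuous σ) (E : QuiverEdge (range σ)) :
    IsOpen (σ ⁻¹' E.1) := by
  refine isOpen_iff_mem_nhds.2 fun x hx => ?_
  obtain ⟨ε, hε, hball⟩ := Metric.mem_nhds_iff.1
    (((isOpen_setOf_isSimplePoint (range σ)).preimage hσ).mem_nhds (isSimplePoint hx))
  exact Filter.mem_of_superset (Metric.ball_mem_nhds x hε)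
    (mapsTo_of_isPreconnected hσ (convex_ball x ε).isPreconnected (fun y hy => hball hy)
      (Metric.mem_ball_self hε) hx)

lemma QuiverEdge.mapsTo_component (E : QuiverEdge (range σ)) (t : ℝ) :
    MapsTo σ (connectedComponentIn (σ ⁻¹' E.1) t) E.1 :=
  connectedComponentIn_subset (σ ⁻¹' E.1) t

lemma QuiverEdge.eqOn_component (h : IsRigid σ) (ht : t ∈ σ ⁻¹' E.1) (htt' : σ t = σ t') :
    EqOn (fun x => σ (x + (t' - t))) σ (connectedComponentIn (σ ⁻¹' E.1) t) :=
  h.eqOn_add isPreconnected_connectedComponentIn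
    (fun _ hx => isSimplePoint (E.mapsTo_component t hx)) (mem_connectedComponentIn ht) htt'

lemma QuiverEdge.mapsTo_add_component (h : IsRigid σ) (ht : t ∈ σ ⁻¹' E.1) (htt' : σ t = σ t') :
    MapsTo (· + (t' - t)) (connectedComponentIn (σ ⁻¹' E.1) t)
      (connectedComponentIn (σ ⁻¹' E.1) t') := by
  rw [mapsTo_iff_image_subset]
  refine (isPreconnected_connectedComponentIn.image _
    (continuous_add_const _).continuousOn).subset_connectedComponentIn
    ⟨t, mem_connectedComponentIn ht, add_sub_cancel t t'⟩ ?_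
  rintro _ ⟨x, hx, rfl⟩
  rw [mem_preimage, show σ (x + (t' - t)) = σ x from eqOn_component h ht htt' hx]
  exact E.mapsTo_component t hx

lemma QuiverEdge.image_component_subset (h : IsRigid σ) (ht : t ∈ σ ⁻¹' E.1) (htt' : σ t = σ t') :
    σ '' connectedComponentIn (σ ⁻¹' E.1) t ⊆ σ '' connectedComponentIn (σ ⁻¹' E.1) t' :=
  image_subset_iff.2 fun _ hx =>
    ⟨_, mapsTo_add_component h ht htt' hx, eqOn_component h ht htt' hx⟩

lemma QuiverEdge.image_component_mem_nhdsWithin (h : IsRigid σ) (ht : t ∈ σ ⁻¹' E.1) :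
    σ '' connectedComponentIn (σ ⁻¹' E.1) t ∈ 𝓝[E.1] (σ t) := by
  obtain ⟨U, hU, hinj⟩ := h.exists_injOn t
  have hcomponent : connectedComponentIn (σ ⁻¹' E.1) t ∈ 𝓝 t :=
    (E.isOpen_preimage h.continuous).connectedComponentIn.mem_nhds (mem_connectedComponentIn ht)
  have himage : σ '' (U ∩ connectedComponentIn (σ ⁻¹' E.1) t) ∈ 𝓝[range σ] (σ t) :=
    (isSimplePoint ht).image_mem_nhdsWithin h.continuous mem_range_self
      (Filter.inter_mem hU hcomponent) (hinj.mono inter_subset_left)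
  exact nhdsWithin_mono _ (E.subset.trans sdiff_subset)
    (Filter.mem_of_superset himage (image_mono inter_subset_right))

/-- The images of the components of `σ⁻¹(E)` are open in `E` and, by translation, pairwise equal
or disjoint, while `E` is connected. -/
lemma QuiverEdge.image_component_eq (h : IsRigid σ) (ht : t ∈ σ ⁻¹' E.1) :
    σ '' connectedComponentIn (σ ⁻¹' E.1) t = E.1 := by
  refine (E.mapsTo_component t).image_subset.antisymm fun q hq => ?_
  refine E.isPreconnected.induction₂
    (P := fun p q => ∀ x, σ x = p → q ∈ σ '' connectedComponentIn (σ ⁻¹' E.1) x)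
    ?nearby ?trans ?symm ht hq t rfl
  case nearby =>
    intro p hp
    obtain ⟨x₀, rfl⟩ := (E.subset hp).1
    filter_upwards [image_component_mem_nhdsWithin h hp] with q hq x hx
    exact image_component_subset h hp hx.symm hq
  case trans =>
    intro p q r _ _ _ hpq hqr x hx
    obtain ⟨y, hy, hyq⟩ := hpq x hx
    rw [connectedComponentIn_eq hy]
    exact hqr y hyq
  case symm =>
    intro p q hp _ hpq y hyq
    obtain ⟨x, rfl⟩ := (E.subset hp).1
    obtain ⟨y', hy', hyq'⟩ := hpq x rfl
    refine image_component_subset h (E.mapsTo_component x hy') (hyq'.trans hyq.symm) ?_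
    rw [← connectedComponentIn_eq hy']
    exact mem_image_of_mem σ (mem_connectedComponentIn hp)

end EdgeComponents

section EdgeArcs

variable {σ : ℝ → ℝ × ℝ} {E F : QuiverEdge (range σ)} {a b a' b' : ℝ}

lemma IsEdgeArc.lt (hE : IsEdgeArc σ E a b) : a < b := by
  obtain ⟨t, ht, hC⟩ := hE
  have htab : t ∈ Ioo a b := hC ▸ mem_connectedComponentIn ht
  exact htab.1.trans htab.2

lemma IsEdgeArc.component_eq (hE : IsEdgeArc σ E a b) {x : ℝ} (hx : x ∈ Ioo a b) :
    connectedComponentIn (σ ⁻¹' E.1) x = Ioo a b := by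
  obtain ⟨t, ht, hC⟩ := hE
  rw [← hC] at hx ⊢
  exact (connectedComponentIn_eq hx).symm

lemma IsEdgeArc.mapsTo (hE : IsEdgeArc σ E a b) : MapsTo σ (Ioo a b) E.1 := fun x hx =>
  E.mapsTo_component x (hE.component_eq hx ▸ hx)

lemma IsEdgeArc.image_eq (h : IsRigid σ) (hE : IsEdgeArc σ E a b) : σ '' Ioo a b = E.1 := by
  obtain ⟨t, ht, hC⟩ := hE
  exact hC ▸ QuiverEdge.image_component_eq h ht

lemma IsEdgeArc.le_and_le (h : IsRigid σ) (hE : IsEdgeArc σ E a b) (hE' : IsEdgeArc σ E a' b')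
    {x y : ℝ} (hx : x ∈ Ioo a b) (hy : y ∈ Ioo a' b') (hxy : σ x = σ y) :
    a' ≤ a + (y - x) ∧ b + (y - x) ≤ b' := by
  have hmaps := QuiverEdge.mapsTo_add_component h (hE.mapsTo hx) hxy
  rw [hE.component_eq hx, hE'.component_eq hy, mapsTo_iff_image_subset, image_add_const_Ioo,
    Ioo_subset_Ioo_iff (by linarith [hE.lt])] at hmaps
  exact hmaps

lemma IsEdgeArc.injOn (h : IsRigid σ) (hE : IsEdgeArc σ E a b) : InjOn σ (Ioo a b) := by
  intro x hx y hy hxy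
  obtain ⟨hleft, hright⟩ := hE.le_and_le h hE hx hy hxy
  linarith

lemma IsEdgeArc.exists_eq_add (h : IsRigid σ) (hE : IsEdgeArc σ E a b)
    (hE' : IsEdgeArc σ E a' b') :
    ∃ d, a' = a + d ∧ b' = b + d ∧ EqOn (fun x => σ (x + d)) σ (Icc a b) := by
  obtain ⟨x, hx⟩ := nonempty_Ioo.2 hE.lt
  obtain ⟨y, hy, hyx⟩ : σ x ∈ σ '' Ioo a' b' := hE'.image_eq h ▸ hE.mapsTo hx
  obtain ⟨hleft, hright⟩ := hE.le_and_le h hE' hx hy hyx.symm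
  obtain ⟨hleft', hright'⟩ := hE'.le_and_le h hE hy hx hyx
  refine ⟨y - x, by linarith, by linarith, ?_⟩
  have hopen := QuiverEdge.eqOn_component h (hE.mapsTo hx) hyx.symm
  rw [hE.component_eq hx] at hopen
  rw [← closure_Ioo hE.lt.ne]
  exact hopen.closure (h.continuous.comp (continuous_add_const _)) h.continuous

lemma IsEdgeArc.sub_eq_sub (h : IsRigid σ) (hE : IsEdgeArc σ E a b) (hE' : IsEdgeArc σ E a' b') :
    b - a = b' - a' := by
  obtain ⟨d, rfl, rfl, -⟩ := hE.exists_eq_add h hE'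
  ring

lemma IsEdgeArc.apply_left_eq (h : IsRigid σ) (hE : IsEdgeArc σ E a b)
    (hE' : IsEdgeArc σ E a' b') : σ a = σ a' := by
  obtain ⟨d, rfl, -, hd⟩ := hE.exists_eq_add h hE'
  exact (hd (left_mem_Icc.2 hE.lt.le)).symm

lemma IsEdgeArc.apply_right_eq (h : IsRigid σ) (hE : IsEdgeArc σ E a b)
    (hE' : IsEdgeArc σ E a' b') : σ b = σ b' := by
  obtain ⟨d, -, rfl, hd⟩ := hE.exists_eq_add h hE'
  exact (hd (right_mem_Icc.2 hE.lt.le)).symm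

lemma Follows.apply_eq (h : IsRigid σ) (hEF : Follows σ E F) (hE : IsEdgeArc σ E a b)
    (hF : IsEdgeArc σ F a' b') : σ b = σ a' := by
  obtain ⟨q, ⟨c, d, hcd, hd⟩, ⟨c', d', hcd', hc'⟩⟩ := hEF
  rw [hE.apply_right_eq h hcd, hd, hF.apply_left_eq h hcd', hc']

lemma IsEdgeArc.intervalIntegral_eq (h : IsRigid σ) (hE : IsEdgeArc σ E a b)
    (hE' : IsEdgeArc σ E a' b') (g : ℝ × ℝ → ℝ) :
    ∫ s in a..b, g (σ s) = ∫ s in a'..b', g (σ s) := by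
  obtain ⟨d, rfl, rfl, hd⟩ := hE.exists_eq_add h hE'
  rw [← intervalIntegral.integral_comp_add_right (fun s => g (σ s)) d]
  refine intervalIntegral.integral_congr fun s hs => ?_
  rw [uIcc_of_le hE.lt.le] at hs
  exact congrArg g (hd hs).symm

lemma IsEdgeArc.not_isSimplePoint_left (h : IsRigid σ) (hE : IsEdgeArc σ E a b) :
    ¬ IsSimplePoint (range σ) (σ a) := by
  intro ha
  obtain ⟨x, hx⟩ := nonempty_Ioo.2 hE.lt
  have hmaps : MapsTo σ (Ico a b) E.1 := by
    refine QuiverEdge.mapsTo_of_isPreconnected h.continuous isPreconnected_Ico (fun y hy => ?_)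
      (Ioo_subset_Ico_self hx) (hE.mapsTo hx)
    rcases hy.1.eq_or_lt with rfl | hay
    · exact ha
    · exact QuiverEdge.isSimplePoint (hE.mapsTo ⟨hay, hy.2⟩)
  have hsub : Ico a b ⊆ Ioo a b :=
    hE.component_eq hx ▸ isPreconnected_Ico.subset_connectedComponentIn (Ioo_subset_Ico_self hx)
      hmaps
  exact lt_irrefl a (hsub (left_mem_Ico.2 hE.lt)).1

end EdgeArcs

section CyclicWords

variable {α : Type*} {l w : List α}

/-- The `j`-th letter of the bi-infinite periodic word `⋯lll⋯`, with `j = 0` at the first letter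
of a copy of `l`. -/
def cyclicGet (l : List α) (hl : l ≠ []) (j : ℤ) : α :=
  l[(j % l.length).toNat]'(by
    have hpos : (0 : ℤ) < l.length := by exact_mod_cast List.length_pos_iff.2 hl
    exact (Int.toNat_lt (Int.emod_nonneg j hpos.ne')).2 (Int.emod_lt_of_pos j hpos))

lemma cyclicGet_natCast_add_mul (hl : l ≠ []) {r : ℕ} (hr : r < l.length) (q : ℤ) :
    cyclicGet l hl (r + q * l.length) = l[r] := by
  have hmod : (((r : ℤ) + q * l.length) % l.length).toNat = r := by
    rw [Int.add_mul_emod_self_right, ← Int.natCast_mod, Int.toNat_natCast, Nat.mod_eq_of_lt hr]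
  simp only [cyclicGet, hmod]

lemma cyclicGet_natCast (hl : l ≠ []) {r : ℕ} (hr : r < l.length) : cyclicGet l hl r = l[r] := by
  simpa using cyclicGet_natCast_add_mul hl hr 0

lemma cyclicGet_periodic (hl : l ≠ []) : Function.Periodic (cyclicGet l hl) l.length := fun j => by
  simp only [cyclicGet, Int.add_emod_right]

lemma exists_eq_natCast_add_mul_length (hl : l ≠ []) (j : ℤ) :
    ∃ (r : ℕ) (q : ℤ), r < l.length ∧ j = r + q * l.length := by
  have hpos : (0 : ℤ) < l.length := by exact_mod_cast List.length_pos_iff.2 hl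
  refine ⟨(j % l.length).toNat, j / l.length,
    (Int.toNat_lt (Int.emod_nonneg j hpos.ne')).2 (Int.emod_lt_of_pos j hpos), ?_⟩
  rw [Int.toNat_of_nonneg (Int.emod_nonneg j hpos.ne'), Int.emod_add_ediv_mul]

lemma range_cyclicGet (hl : l ≠ []) : range (cyclicGet l hl) = {x | x ∈ l} := by
  refine Subset.antisymm ?_ fun x hx => ?_
  · rintro _ ⟨j, rfl⟩
    exact List.getElem_mem _
  · obtain ⟨r, hr, rfl⟩ := List.getElem_of_mem hx
    exact ⟨r, cyclicGet_natCast hl hr⟩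

lemma length_wordPow (w : List α) (m : ℕ) : (wordPow w m).length = m * w.length := by
  simp [wordPow]

lemma ne_nil_of_wordPow_ne_nil {m : ℕ} (hW : wordPow w m ≠ []) : w ≠ [] := by
  rintro rfl
  simp [wordPow] at hW

lemma getElem_wordPow {m i : ℕ} (hi : i < (wordPow w m).length) (hi' : i % w.length < w.length) :
    (wordPow w m)[i] = w[i % w.length] := by
  induction m generalizing i with
  | zero => simp [wordPow] at hi
  | succ m ih =>
    have hsucc : wordPow w (m + 1) = w ++ wordPow w m := by simp [wordPow, List.replicate_succ]
    simp only [hsucc, List.getElem_append]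
    split_ifs with hiw
    · simp only [Nat.mod_eq_of_lt hiw]
    · have hmod : (i - w.length) % w.length = i % w.length :=
        (Nat.mod_eq_sub_mod (not_lt.1 hiw)).symm
      simp only [ih _ (hmod.symm ▸ hi'), hmod]

lemma cyclicGet_wordPow {m : ℕ} (hw : w ≠ []) (hW : wordPow w m ≠ []) :
    cyclicGet (wordPow w m) hW = cyclicGet w hw := by
  funext j
  obtain ⟨r, q, hr, rfl⟩ := exists_eq_natCast_add_mul_length hW j
  have hmod : r % w.length < w.length := Nat.mod_lt r (List.length_pos_iff.2 hw)
  rw [cyclicGet_natCast_add_mul hW hr, getElem_wordPow hr hmod,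
    ← cyclicGet_natCast_add_mul hw hmod (q * m + (r / w.length : ℕ)), length_wordPow]
  congr 1
  have hdiv : (r : ℤ) = (r % w.length : ℕ) + w.length * (r / w.length : ℕ) := by
    exact_mod_cast (Nat.mod_add_div r w.length).symm
  push_cast at hdiv ⊢
  linear_combination -hdiv

lemma eq_wordPow_take_of_periodic (hw : w ≠ []) {g k : ℕ} (hlen : w.length = k * g)
    (hper : Function.Periodic (cyclicGet w hw) g) : w = wordPow (w.take g) k := by
  have hpos : 0 < k * g := hlen ▸ List.length_pos_iff.2 hw
  have hg : 0 < g := Nat.pos_of_mul_pos_left hpos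
  have htake : (w.take g).length = g := by
    rw [List.length_take, min_eq_left]
    exact hlen ▸ Nat.le_mul_of_pos_left g (Nat.pos_of_mul_pos_right hpos)
  refine List.ext_getElem (by rw [length_wordPow, htake, hlen]) fun i hi hi' => ?_
  have hmod : i % g < w.length := (Nat.mod_le i g).trans_lt hi
  rw [getElem_wordPow hi' (htake.symm ▸ Nat.mod_lt i hg), List.getElem_take]
  simp only [htake]
  rw [← cyclicGet_natCast hw hi, ← cyclicGet_natCast hw hmod,
    ← hper.nat_mul (i / g) (i % g : ℕ)]
  congr 1
  exact_mod_cast (Nat.mod_add_div' i g).symm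

lemma length_dvd_of_periodic_cyclicGet (hw : w ≠ []) (hprim : ¬ IsPeriodicWord w) {d : ℤ}
    (hd : Function.Periodic (cyclicGet w hw) d) : (w.length : ℤ) ∣ d := by
  have hgcd : Function.Periodic (cyclicGet w hw) (Int.gcd w.length d : ℕ) := by
    rw [Int.gcd_eq_gcd_ab, mul_comm _ (Int.gcdA _ _), mul_comm d]
    exact ((cyclicGet_periodic hw).int_mul _).add_period (hd.int_mul _)
  obtain ⟨k, hk⟩ : Int.gcd w.length d ∣ w.length := by
    exact_mod_cast Int.gcd_dvd_left (w.length : ℤ) d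
  rw [mul_comm] at hk
  have hk1 : ¬ 1 < k := fun hk1 => hprim ⟨_, k, hk1, eq_wordPow_take_of_periodic hw hk hgcd⟩
  have hk0 : k ≠ 0 := by
    rintro rfl
    exact hw (List.length_eq_zero_iff.1 (hk.trans (zero_mul _)))
  rw [show k = 1 by lia, one_mul] at hk
  exact hk ▸ Int.gcd_dvd_right (w.length : ℤ) d

lemma encard_cyclicGet_eq (hl : l ≠ []) (x : α) :
    {r : ℤ | 0 ≤ r ∧ r < l.length ∧ cyclicGet l hl r = x}.encard = (multiplicity l x : ℕ∞) := by
  let _ := Classical.decEq α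
  have himage : {r : ℤ | 0 ≤ r ∧ r < l.length ∧ cyclicGet l hl r = x} =
      (fun i : Fin l.length => (i : ℤ)) '' {i | l.get i = x} := by
    ext r
    constructor
    · rintro ⟨h0, hr, hx⟩
      lift r to ℕ using h0
      have hr' : r < l.length := by exact_mod_cast hr
      exact ⟨⟨r, hr'⟩, (cyclicGet_natCast hl hr').symm.trans hx, rfl⟩
    · rintro ⟨i, hi, rfl⟩
      exact ⟨by positivity, Nat.cast_lt.2 i.2, (cyclicGet_natCast hl i.2).trans hi⟩
  have hinj : Function.Injective fun i : Fin l.length => (i : ℤ) :=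
    Nat.cast_injective.comp Fin.val_injective
  rw [himage, hinj.encard_image, ← Finset.coe_filter_univ, encard_coe_eq_coe_finsetCard]
  exact congrArg _ (Fin.card_filter_univ_eq_vector_get_eq_count x ⟨l, rfl⟩)

lemma iInf_encard_cyclicGet (hl : l ≠ []) :
    ⨅ j : ℤ, {r : ℤ | 0 ≤ r ∧ r < l.length ∧ cyclicGet l hl r = cyclicGet l hl j}.encard =
      ⨅ x ∈ l, (multiplicity l x : ℕ∞) := by
  simp only [encard_cyclicGet_eq]
  rw [← iInf_range (f := cyclicGet l hl) (g := fun x => (multiplicity l x : ℕ∞)),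
    range_cyclicGet hl]
  rfl

lemma finsum_multiplicity_mul (l : List α) (f : α → ℝ) :
    ∑ᶠ x, (multiplicity l x : ℝ) * f x = (l.map f).sum := by
  let _ := Classical.decEq α
  have hsupport : (Function.support fun x => (multiplicity l x : ℝ) * f x) ⊆ l.toFinset := by
    intro x hx
    by_contra hxl
    exact hx (by simp [multiplicity, List.count_eq_zero_of_not_mem fun h => hxl (by simpa using h)])
  rw [Finset.sum_list_map_count, finsum_eq_sum_of_support_subset _ hsupport]
  exact Finset.sum_congr rfl fun x _ => (nsmul_eq_mul _ _).symm

end CyclicWords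

section Subdivisions

/-- The points `c j`, with `j` running through `ℤ`, cut the real line into the successive
intervals `[c j, c (j + 1))`. -/
structure IsSubdivision (c : ℤ → ℝ) : Prop where
  strictMono : StrictMono c
  exists_mem_Ico : ∀ s, ∃ j, s ∈ Ico (c j) (c (j + 1))

variable {c : ℤ → ℝ} {p : ℝ} {n : ℤ}

lemma eq_apply_zero_of_periodic_one {β : Type*} {f : ℤ → β} (hf : Function.Periodic f 1) (j : ℤ) :
    f j = f 0 := by
  simpa using hf.int_mul_eq j

lemma apply_mul_of_forall_apply_add (h : ∀ j, c (j + n) = c j + p) (k : ℤ) :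
    c (k * n) = c 0 + k * p := by
  have hper : Function.Periodic (fun k : ℤ => c (k * n) - k * p) 1 := fun k => by
    push_cast
    rw [add_mul, one_mul, h]
    ring
  simpa [sub_eq_iff_eq_add] using eq_apply_zero_of_periodic_one hper k

lemma isSubdivision_of_forall_apply_add (hc : StrictMono c) (hn : 0 < n)
    (h : ∀ j, c (j + n) = c j + p) : IsSubdivision c := by
  refine ⟨hc, fun s => ?_⟩
  have hp : 0 < p := by linarith [hc hn, zero_add n ▸ h 0]
  have hex : ∃ k, c k ≤ s := ⟨⌊(s - c 0) / p⌋ * n, by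
    rw [apply_mul_of_forall_apply_add h]
    linarith [(le_div_iff₀ hp).1 (Int.floor_le ((s - c 0) / p))]⟩
  have hbound : s < c ((⌊(s - c 0) / p⌋ + 1) * n) := by
    rw [apply_mul_of_forall_apply_add h]
    push_cast
    linarith [(div_lt_iff₀ hp).1 (Int.lt_floor_add_one ((s - c 0) / p))]
  obtain ⟨j, hj, hmax⟩ := Int.exists_greatest_of_bdd
    ⟨_, fun k hk => (hc.lt_iff_lt.1 (hk.trans_lt hbound)).le⟩ hex
  exact ⟨j, hj, not_le.1 fun hle => (hmax _ hle).not_gt (lt_add_one j)⟩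

lemma IsSubdivision.lt_succ (hc : IsSubdivision c) (j : ℤ) : c j < c (j + 1) :=
  hc.strictMono (lt_add_one j)

lemma IsSubdivision.exists_mem_Ioc (hc : IsSubdivision c) (s : ℝ) :
    ∃ j, s ∈ Ioc (c j) (c (j + 1)) := by
  obtain ⟨j, hj⟩ := hc.exists_mem_Ico s
  rcases hj.1.eq_or_lt with rfl | hlt
  · exact ⟨j - 1, hc.strictMono (sub_one_lt j), by rw [sub_add_cancel]⟩
  · exact ⟨j, hlt, hj.2.le⟩

lemma IsSubdivision.exists_eventuallyEq_nhdsLE {β : Type*} (hc : IsSubdivision c) {f : ℝ → β}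
    {g : ℤ → ℝ → β} (hfg : ∀ j, EqOn f (g j) (Icc (c j) (c (j + 1)))) (s : ℝ) :
    ∃ j, s ∈ Icc (c j) (c (j + 1)) ∧ f =ᶠ[𝓝[≤] s] g j := by
  obtain ⟨j, hj⟩ := hc.exists_mem_Ioc s
  refine ⟨j, Ioc_subset_Icc_self hj, ?_⟩
  filter_upwards [Ioc_mem_nhdsLE hj.1] with x hx using hfg j ⟨hx.1.le, hx.2.trans hj.2⟩

lemma IsSubdivision.exists_eventuallyEq_nhdsGE {β : Type*} (hc : IsSubdivision c) {f : ℝ → β}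
    {g : ℤ → ℝ → β} (hfg : ∀ j, EqOn f (g j) (Icc (c j) (c (j + 1)))) (s : ℝ) :
    ∃ j, s ∈ Icc (c j) (c (j + 1)) ∧ f =ᶠ[𝓝[≥] s] g j := by
  obtain ⟨j, hj⟩ := hc.exists_mem_Ico s
  refine ⟨j, Ico_subset_Icc_self hj, ?_⟩
  filter_upwards [Ico_mem_nhdsGE hj.2] with x hx using hfg j ⟨hj.1.trans hx.1, hx.2.le⟩

lemma IsSubdivision.continuous_of_eqOn {X : Type*} [TopologicalSpace X] (hc : IsSubdivision c)
    {f : ℝ → X} {g : ℤ → ℝ → X} (hg : ∀ j, Continuous (g j))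
    (hfg : ∀ j, EqOn f (g j) (Icc (c j) (c (j + 1)))) : Continuous f := by
  refine continuous_iff_continuousAt.2 fun s => continuousAt_iff_continuous_left_right.2 ⟨?_, ?_⟩
  · obtain ⟨j, hj, hev⟩ := hc.exists_eventuallyEq_nhdsLE hfg s
    exact (hg j).continuousWithinAt.congr_of_eventuallyEq hev (hfg j hj)
  · obtain ⟨j, hj, hev⟩ := hc.exists_eventuallyEq_nhdsGE hfg s
    exact (hg j).continuousWithinAt.congr_of_eventuallyEq hev (hfg j hj)

lemma IsSubdivision.hasDerivAt_of_eqOn {F : Type*} [NormedAddCommGroup F] [NormedSpace ℝ F]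
    (hc : IsSubdivision c) {f f' : ℝ → F} {g g' : ℤ → ℝ → F}
    (hg : ∀ j s, HasDerivAt (g j) (g' j s) s)
    (hfg : ∀ j, EqOn f (g j) (Icc (c j) (c (j + 1))))
    (hfg' : ∀ j, EqOn f' (g' j) (Icc (c j) (c (j + 1)))) (s : ℝ) : HasDerivAt f (f' s) s := by
  rw [← hasDerivWithinAt_univ, ← Iic_union_Ici (a := s)]
  refine HasDerivWithinAt.union ?_ ?_
  · obtain ⟨j, hj, hev⟩ := hc.exists_eventuallyEq_nhdsLE hfg s
    rw [hfg' j hj]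
    exact (hg j s).hasDerivWithinAt.congr_of_eventuallyEq hev (hfg j hj)
  · obtain ⟨j, hj, hev⟩ := hc.exists_eventuallyEq_nhdsGE hfg s
    rw [hfg' j hj]
    exact (hg j s).hasDerivWithinAt.congr_of_eventuallyEq hev (hfg j hj)

/-- Translation by `p` induces an order automorphism of `ℤ`, which commutes with the successor. -/
lemma exists_forall_apply_add_eq (hc : StrictMono c) (hadd : ∀ j, c j + p ∈ range c)
    (hsub : ∀ j, c j - p ∈ range c) : ∃ d, ∀ j, c (j + d) = c j + p := by
  choose f hf using hadd
  have hmono : StrictMono f := fun i j hij => by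
    rw [← hc.lt_iff_lt, hf, hf]
    exact add_lt_add_left (hc hij) p
  have hsurj : Function.Surjective f := fun j => by
    obtain ⟨i, hi⟩ := hsub j
    exact ⟨i, hc.injective (by rw [hf, hi, sub_add_cancel])⟩
  have hsucc : ∀ j, f (j + 1) = f j + 1 :=
    (hmono.orderIsoOfSurjective f hsurj).map_succ
  have hper : Function.Periodic (fun j => f j - j) 1 := fun j => by
    simp only [hsucc]
    ring
  refine ⟨f 0, fun j => ?_⟩
  have hshift : f j - j = f 0 - 0 := eq_apply_zero_of_periodic_one hper j
  rw [← hf, show j + f 0 = f j by linarith]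

end Subdivisions

section Reshuffling

variable {I : List (ℝ × ℝ)}

lemma totalLength_cons (p : ℝ × ℝ) (I : List (ℝ × ℝ)) :
    totalLength (p :: I) = p.2 - p.1 + totalLength I := by
  simp [totalLength]

lemma totalLength_append (I J : List (ℝ × ℝ)) :
    totalLength (I ++ J) = totalLength I + totalLength J := by
  simp [totalLength]

lemma totalLength_take_succ {r : ℕ} (hr : r < I.length) :
    totalLength (I.take (r + 1)) = totalLength (I.take r) + (I[r].2 - I[r].1) := by
  rw [List.take_add_one, List.getElem?_eq_getElem hr, totalLength_append]
  simp [totalLength]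

lemma totalLength_nonneg (hI : ∀ p ∈ I, p.1 < p.2) : 0 ≤ totalLength I :=
  List.sum_nonneg <| List.forall_mem_map.2 fun p hp => (sub_pos.2 (hI p hp)).le

lemma totalLength_take_le (hI : ∀ p ∈ I, p.1 < p.2) (r : ℕ) :
    totalLength (I.take r) ≤ totalLength I := by
  have hdrop := totalLength_nonneg fun p hp => hI p (List.mem_of_mem_drop (i := r) hp)
  have hsplit := totalLength_append (I.take r) (I.drop r)
  rw [List.take_append_drop] at hsplit
  linarith

lemma concatenate_eq (κ : ℝ → ℝ) (hI : ∀ p ∈ I, p.1 < p.2) {r : ℕ} (hr : r < I.length) {s : ℝ}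
    (hs : s ∈ Ico (totalLength (I.take r)) (totalLength (I.take (r + 1)))) :
    concatenate κ I s = κ (I[r].1 + (s - totalLength (I.take r))) := by
  induction I generalizing r s with
  | nil => simp at hr
  | cons p I ih =>
    obtain ⟨-, hI⟩ := List.forall_mem_cons.1 hI
    cases r with
    | zero =>
      have hnil : totalLength [] = 0 := rfl
      simp only [zero_add, List.take_succ_cons, List.take_zero, totalLength_cons, hnil,
        add_zero] at hs
      simp only [concatenate, if_pos hs.2, List.take_zero, hnil, List.getElem_cons_zero, sub_zero,
        add_comm]
    | succ r =>
      simp only [List.take_succ_cons, totalLength_cons, mem_Ico] at hs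
      have hnonneg := totalLength_nonneg fun q hq => hI q (List.mem_of_mem_take (i := r) hq)
      have hlast : ¬ s < p.2 - p.1 := by linarith
      simp only [concatenate, if_neg hlast, List.take_succ_cons, totalLength_cons,
        List.getElem_cons_succ]
      rw [ih hI (Nat.lt_of_succ_lt_succ hr) ⟨by linarith, by linarith⟩, sub_sub]

/-- The breakpoints `c_j` of the periodic concatenation of a list of intervals, indexed by `ℤ`
so that the breakpoint `c_0` is `0`. -/
noncomputable def breakpoint (I : List (ℝ × ℝ)) (j : ℤ) : ℝ :=
  totalLength (I.take (j % I.length).toNat) + (j / I.length : ℤ) * totalLength I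

lemma breakpoint_zero (I : List (ℝ × ℝ)) : breakpoint I 0 = 0 := by
  simp [breakpoint, totalLength]

lemma breakpoint_add_length (hI : I ≠ []) (j : ℤ) :
    breakpoint I (j + I.length) = breakpoint I j + totalLength I := by
  have hlength : (I.length : ℤ) ≠ 0 := by exact_mod_cast (List.length_pos_iff.2 hI).ne'
  rw [breakpoint, breakpoint, Int.add_emod_right, Int.add_ediv_of_dvd_right dvd_rfl,
    Int.ediv_self hlength]
  push_cast
  ring

lemma breakpoint_length (hI : I ≠ []) : breakpoint I I.length = totalLength I := by
  simpa [breakpoint_zero] using breakpoint_add_length hI 0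

lemma breakpoint_natCast_add_mul (hI : I ≠ []) {r : ℕ} (hr : r ≤ I.length) (q : ℤ) :
    breakpoint I (r + q * I.length) = totalLength (I.take r) + q * totalLength I := by
  have hper : Function.Periodic
      (fun q : ℤ => breakpoint I (r + q * I.length) - q * totalLength I) 1 := fun q => by
    push_cast
    rw [add_mul, one_mul, ← add_assoc, breakpoint_add_length hI]
    ring
  have hzero : breakpoint I r = totalLength (I.take r) := by
    rcases hr.lt_or_eq with hlt | rfl
    · rw [breakpoint, Int.emod_eq_of_lt (by positivity) (by exact_mod_cast hlt),
        Int.ediv_eq_zero_of_lt (by positivity) (by exact_mod_cast hlt)]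
      simp
    · rw [breakpoint_length hI, List.take_length]
  simpa [hzero, sub_eq_iff_eq_add] using eq_apply_zero_of_periodic_one hper q

lemma breakpoint_succ (hI : I ≠ []) (j : ℤ) :
    breakpoint I (j + 1) = breakpoint I j + ((cyclicGet I hI j).2 - (cyclicGet I hI j).1) := by
  obtain ⟨r, q, hr, rfl⟩ := exists_eq_natCast_add_mul_length hI j
  rw [cyclicGet_natCast_add_mul hI hr, breakpoint_natCast_add_mul hI hr.le, add_right_comm,
    ← Nat.cast_add_one, breakpoint_natCast_add_mul hI hr, totalLength_take_succ hr]
  ring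

lemma isSubdivision_breakpoint (hI : I ≠ []) (hlt : ∀ p ∈ I, p.1 < p.2) :
    IsSubdivision (breakpoint I) := by
  refine isSubdivision_of_forall_apply_add (strictMono_int_of_lt_succ fun j => ?_)
    (Nat.cast_pos.2 (List.length_pos_iff.2 hI)) (breakpoint_add_length hI)
  have hmem : cyclicGet I hI j ∈ I := List.getElem_mem _
  linarith [breakpoint_succ hI j, hlt _ hmem]

lemma reshuffle_eq (κ : ℝ → ℝ) (hI : I ≠ []) (hlt : ∀ p ∈ I, p.1 < p.2) {j : ℤ} {s : ℝ}
    (hs : s ∈ Ico (breakpoint I j) (breakpoint I (j + 1))) :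
    reshuffle κ I s = κ ((cyclicGet I hI j).1 + (s - breakpoint I j)) := by
  obtain ⟨r, q, hr, rfl⟩ := exists_eq_natCast_add_mul_length hI j
  rw [add_right_comm, ← Nat.cast_add_one, breakpoint_natCast_add_mul hI hr.le,
    breakpoint_natCast_add_mul hI hr] at hs
  have hleft := totalLength_nonneg fun p hp => hlt p (List.mem_of_mem_take (i := r) hp)
  have hright := totalLength_take_le hlt (r + 1)
  have hpos : 0 < totalLength I := by linarith [hs.1, hs.2]
  have hfloor : ⌊s / totalLength I⌋ = q := by
    rw [Int.floor_eq_iff, le_div_iff₀ hpos, div_lt_iff₀ hpos]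
    constructor <;> linarith [hs.1, hs.2]
  rw [reshuffle, hfloor, concatenate_eq κ hlt hr ⟨by linarith [hs.1], by linarith [hs.2]⟩,
    cyclicGet_natCast_add_mul hI hr, breakpoint_natCast_add_mul hI hr.le]
  congr 1
  ring

end Reshuffling

section ArcChains

variable {σ : ℝ → ℝ × ℝ} {e : ℤ → QuiverEdge (range σ)} {a c : ℤ → ℝ} {τ : ℝ → ℝ × ℝ}
  {n d : ℤ}

/-- The map `τ` runs successively through arcs `(a j, b j)` of the edges `e j`: the `j`-th arc is
run through on the interval `[c j, c (j + 1)]`, so that `b j = a j + (c (j + 1) - c j)`. -/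
structure IsArcChain (σ : ℝ → ℝ × ℝ) (e : ℤ → QuiverEdge (range σ)) (a c : ℤ → ℝ)
    (τ : ℝ → ℝ × ℝ) : Prop where
  isSubdivision : IsSubdivision c
  zero : c 0 = 0
  arc : ∀ j, IsEdgeArc σ (e j) (a j) (a j + (c (j + 1) - c j))
  eqOn : ∀ j, EqOn τ (fun s => σ (a j + (s - c j))) (Icc (c j) (c (j + 1)))

namespace IsArcChain

lemma continuous (hc : IsArcChain σ e a c τ) (hσ : Continuous σ) : Continuous τ :=
  hc.isSubdivision.continuous_of_eqOn (fun _ => hσ.comp (by fun_prop)) hc.eqOn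

lemma hasDerivAt_fst (hc : IsArcChain σ e a c τ)
    (hσ : ∀ s, HasDerivAt (fun x => (σ x).1) (σ s).2 s) (s : ℝ) :
    HasDerivAt (fun x => (τ x).1) (τ s).2 s := by
  refine hc.isSubdivision.hasDerivAt_of_eqOn (f := fun x => (τ x).1) (f' := fun x => (τ x).2)
    (fun j x => ?_) (fun j x hx => congrArg Prod.fst (hc.eqOn j hx))
    (fun j x hx => congrArg Prod.snd (hc.eqOn j hx)) s
  have hshift : HasDerivAt (fun y => a j + (y - c j)) 1 x :=
    ((hasDerivAt_id x).sub_const (c j)).const_add (a j)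
  simpa only [mul_one, Function.comp_def] using (hσ (a j + (x - c j))).comp x hshift

lemma apply_add (hc : IsArcChain σ e a c τ) {j : ℤ} {x : ℝ} (hx : x ∈ Icc 0 (c (j + 1) - c j)) :
    τ (c j + x) = σ (a j + x) := by
  rw [hc.eqOn j ⟨by linarith [hx.1], by linarith [hx.2]⟩]
  simp only [add_sub_cancel_left]

lemma mapsTo (hc : IsArcChain σ e a c τ) (j : ℤ) : MapsTo τ (Ioo (c j) (c (j + 1))) (e j).1 :=
  fun s hs => by
    rw [hc.eqOn j (Ioo_subset_Icc_self hs)]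
    exact (hc.arc j).mapsTo ⟨by linarith [hs.1], by linarith [hs.2]⟩

lemma injOn (h : IsRigid σ) (hc : IsArcChain σ e a c τ) (j : ℤ) :
    InjOn τ (Ioo (c j) (c (j + 1))) := by
  intro s hs s' hs' heq
  rw [hc.eqOn j (Ioo_subset_Icc_self hs), hc.eqOn j (Ioo_subset_Icc_self hs')] at heq
  linarith [(hc.arc j).injOn h ⟨by linarith [hs.1], by linarith [hs.2]⟩
    ⟨by linarith [hs'.1], by linarith [hs'.2]⟩ heq]

lemma arc_of_eq (hc : IsArcChain σ e a c τ) {i j : ℤ} (hij : e i = e j) :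
    IsEdgeArc σ (e i) (a j) (a j + (c (j + 1) - c j)) := by
  rw [hij]
  exact hc.arc j

lemma sub_eq_sub (h : IsRigid σ) (hc : IsArcChain σ e a c τ) {i j : ℤ} (hij : e i = e j) :
    c (i + 1) - c i = c (j + 1) - c j := by
  simpa using (hc.arc i).sub_eq_sub h (hc.arc_of_eq hij)

lemma apply_add_eq_apply_add (h : IsRigid σ) (hc : IsArcChain σ e a c τ) {i j : ℤ}
    (hij : e i = e j) {x : ℝ} (hx : x ∈ Icc 0 (c (j + 1) - c j)) : τ (c i + x) = τ (c j + x) := by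
  rw [hc.apply_add hx, hc.apply_add (hc.sub_eq_sub h hij ▸ hx)]
  obtain ⟨d, hd, -, heqOn⟩ := (hc.arc i).exists_eq_add h (hc.arc_of_eq hij)
  rw [hd, add_right_comm]
  refine (heqOn ⟨by linarith [hx.1], ?_⟩).symm
  linarith [hx.2, hc.sub_eq_sub h hij]

lemma apply_add_of_periodic (h : IsRigid σ) (hc : IsArcChain σ e a c τ)
    (hd : Function.Periodic e d) (j : ℤ) : c (j + d) = c j + c d := by
  have hper : Function.Periodic (fun j => c (j + d) - c j) 1 := fun j => by
    have hlength := hc.sub_eq_sub h (hd j)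
    simp only [add_right_comm j 1 d]
    linarith
  have hzero := eq_apply_zero_of_periodic_one hper j
  simp only [zero_add, hc.zero] at hzero
  linarith

lemma apply_mul_of_periodic (h : IsRigid σ) (hc : IsArcChain σ e a c τ)
    (hd : Function.Periodic e d) (k : ℤ) : c (k * d) = k * c d := by
  rw [apply_mul_of_forall_apply_add (hc.apply_add_of_periodic h hd), hc.zero, zero_add]

lemma periodic_apply (h : IsRigid σ) (hc : IsArcChain σ e a c τ) (hd : Function.Periodic e d) :
    Function.Periodic τ (c d) := by
  intro s
  obtain ⟨j, hj⟩ := hc.isSubdivision.exists_mem_Ico s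
  have heq := hc.apply_add_eq_apply_add h (hd j) (x := s - c j)
    ⟨by linarith [hj.1], by linarith [hj.2]⟩
  rwa [hc.apply_add_of_periodic h hd, show c j + c d + (s - c j) = s + c d by ring,
    add_sub_cancel] at heq

lemma isSimplePoint_iff (h : IsRigid σ) (hc : IsArcChain σ e a c τ) {s : ℝ} :
    IsSimplePoint (range σ) (τ s) ↔ s ∉ range c := by
  constructor
  · rintro hs ⟨j, rfl⟩
    rw [hc.eqOn j (left_mem_Icc.2 (hc.isSubdivision.lt_succ j).le)] at hs
    exact (hc.arc j).not_isSimplePoint_left h (by simpa using hs)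
  · intro hs
    obtain ⟨j, hj⟩ := hc.isSubdivision.exists_mem_Ico s
    exact QuiverEdge.isSimplePoint
      (hc.mapsTo j ⟨hj.1.lt_of_ne fun heq => hs ⟨j, heq⟩, hj.2⟩)

lemma exists_periodic_of_periodic (h : IsRigid σ) (hc : IsArcChain σ e a c τ) {p : ℝ}
    (hp : Function.Periodic τ p) : ∃ d, c d = p ∧ Function.Periodic e d := by
  have hrange : ∀ {q : ℝ}, Function.Periodic τ q → ∀ j, c j + q ∈ range c := fun {q} hq j => by
    have hiff := hc.isSimplePoint_iff h (s := c j + q)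
    rw [hq, hc.isSimplePoint_iff h] at hiff
    exact (not_iff_not.1 hiff).1 (mem_range_self j)
  obtain ⟨d, hd⟩ := exists_forall_apply_add_eq hc.isSubdivision.strictMono (hrange hp)
    fun j => sub_eq_add_neg (c j) p ▸ hrange hp.neg j
  refine ⟨d, by simpa [hc.zero] using hd 0, fun j => ?_⟩
  obtain ⟨x, hx⟩ := exists_between (hc.isSubdivision.lt_succ j)
  have hxp : τ (x + p) ∈ (e (j + d)).1 := by
    refine hc.mapsTo (j + d) ⟨?_, ?_⟩
    · rw [hd]
      exact add_lt_add_left hx.1 p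
    · rw [add_right_comm, hd]
      exact add_lt_add_left hx.2 p
  rw [hp] at hxp
  exact QuiverEdge.eq_of_mem hxp (hc.mapsTo j hx)

lemma encard_le_encard_fiber (h : IsRigid σ) (hc : IsArcChain σ e a c τ) {j : ℤ} {u : ℝ}
    (hu : u ∈ Ico (c j) (c (j + 1))) :
    {r : ℤ | 0 ≤ r ∧ r < n ∧ e r = e j}.encard ≤
      {s | s ∈ Ico 0 (c n) ∧ τ s = τ u}.encard := by
  have hmono := hc.isSubdivision.strictMono
  refine encard_le_encard_of_injOn (f := fun r => c r + (u - c j)) ?_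
    fun r _ r' _ heq => hmono.injective (add_right_cancel heq)
  rintro r ⟨hr0, hrn, hrj⟩
  have hlength := hc.sub_eq_sub h hrj
  have hright : c (r + 1) ≤ c n := hmono.monotone hrn
  have hleft : c 0 ≤ c r := hmono.monotone hr0
  rw [hc.zero] at hleft
  refine ⟨⟨by linarith [hu.1], by linarith [hu.2]⟩, ?_⟩
  simpa using hc.apply_add_eq_apply_add h hrj (x := u - c j)
    ⟨by linarith [hu.1], by linarith [hu.2]⟩

lemma encard_fiber_le (h : IsRigid σ) (hc : IsArcChain σ e a c τ) {j : ℤ} {u : ℝ}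
    (hu : u ∈ Ioo (c j) (c (j + 1))) :
    {s | s ∈ Ico 0 (c n) ∧ τ s = τ u}.encard ≤
      {r : ℤ | 0 ≤ r ∧ r < n ∧ e r = e j}.encard := by
  have hmono := hc.isSubdivision.strictMono
  have huj := hc.mapsTo j hu
  refine (encard_le_encard ?_).trans (encard_image_le (fun r => c r + (u - c j)) _)
  rintro s ⟨hs, hsu⟩
  obtain ⟨r, hr⟩ := hc.isSubdivision.exists_mem_Ico s
  have hcr : c r < s := hr.1.lt_of_ne fun heq =>
    (hc.isSimplePoint_iff h).1 (hsu ▸ QuiverEdge.isSimplePoint huj) ⟨r, heq⟩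
  have hrj : e r = e j := QuiverEdge.eq_of_mem (hsu ▸ hc.mapsTo r ⟨hcr, hr.2⟩) huj
  refine ⟨r, ⟨?_, hmono.lt_iff_lt.1 (hr.1.trans_lt hs.2), hrj⟩, ?_⟩
  · exact Int.lt_add_one_iff.1 (hmono.lt_iff_lt.1 (hc.zero.trans_le hs.1 |>.trans_lt hr.2))
  · have hlength := hc.sub_eq_sub h hrj
    have hshift := hc.apply_add_eq_apply_add h hrj (x := s - c r)
      ⟨by linarith, by linarith [hr.2]⟩
    rw [add_sub_cancel, hsu] at hshift
    have := hc.injOn h j hu ⟨by linarith, by linarith [hr.2]⟩ hshift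
    simp only
    linarith

lemma iInf_encard_fiber (h : IsRigid σ) (hc : IsArcChain σ e a c τ) :
    ⨅ ζ ∈ range τ, {s | s ∈ Ico 0 (c n) ∧ τ s = ζ}.encard =
      ⨅ j : ℤ, {r : ℤ | 0 ≤ r ∧ r < n ∧ e r = e j}.encard := by
  rw [iInf_range]
  refine le_antisymm (le_iInf fun j => ?_) (le_iInf fun u => ?_)
  · obtain ⟨u, hu⟩ := exists_between (hc.isSubdivision.lt_succ j)
    exact (iInf_le _ u).trans (hc.encard_fiber_le h hu)
  · obtain ⟨j, hj⟩ := hc.isSubdivision.exists_mem_Ico u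
    exact (iInf_le _ j).trans (hc.encard_le_encard_fiber h hj)

lemma intervalIntegral_eq_sum (hc : IsArcChain σ e a c τ) (hτ : Continuous τ) {g : ℝ × ℝ → ℝ}
    (hg : Continuous g) (n : ℕ) :
    ∫ s in (0 : ℝ)..c n, g (τ s) =
      ∑ r ∈ Finset.range n, ∫ s in (a r)..(a r + (c (r + 1) - c r)), g (σ s) := by
  have hsum := intervalIntegral.sum_integral_adjacent_intervals (a := fun r : ℕ => c r) (n := n)
    fun _ _ => (hg.comp hτ).intervalIntegrable (μ := MeasureTheory.volume) _ _
  rw [Nat.cast_zero, hc.zero] at hsum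
  refine hsum.symm.trans (Finset.sum_congr rfl fun r _ => ?_)
  have hpiece : EqOn (fun s => g (τ s)) (fun s => g (σ (a r - c r + s)))
      (uIcc (c r) (c (r + 1))) := fun s hs => by
    rw [uIcc_of_le (hc.isSubdivision.lt_succ r).le] at hs
    simp only [hc.eqOn r hs]
    congr 2
    ring
  push_cast
  refine (intervalIntegral.integral_congr hpiece).trans ?_
  rw [intervalIntegral.integral_comp_add_left (fun s => g (σ s))]
  congr 1 <;> ring

end IsArcChain

end ArcChains

section ClosedPaths

variable {σ : ℝ → ℝ × ℝ} {W : List (QuiverEdge (range σ))} {I : List (ℝ × ℝ)}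

lemma IsClosedPath.follows_cyclicGet (hW : IsClosedPath σ W) (hne : W ≠ []) (j : ℤ) :
    Follows σ (cyclicGet W hne j) (cyclicGet W hne (j + 1)) := by
  obtain ⟨hchain, _, hlast⟩ := hW
  obtain ⟨r, q, hr, rfl⟩ := exists_eq_natCast_add_mul_length hne j
  rw [cyclicGet_natCast_add_mul hne hr]
  rcases Nat.lt_or_eq_of_le (Nat.succ_le_of_lt hr) with hr' | hr'
  · rw [add_right_comm, ← Nat.cast_add_one, cyclicGet_natCast_add_mul hne hr']
    exact hchain.getElem r hr'
  · have hnext : (r : ℤ) + q * W.length + 1 = (0 : ℕ) + (q + 1) * W.length := by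
      rw [← hr']
      push_cast
      ring
    rw [hnext, cyclicGet_natCast_add_mul hne (List.length_pos_iff.2 hne)]
    rw [List.getLast_eq_getElem, List.head_eq_getElem] at hlast
    simpa only [← hr', Nat.succ_eq_add_one, Nat.add_sub_cancel] using hlast

lemma isEdgeArc_cyclicGet (hne : W ≠ []) (hIne : I ≠ [])
    (hI : List.Forall₂ (fun E p => IsEdgeArc σ E p.1 p.2) W I) (j : ℤ) :
    IsEdgeArc σ (cyclicGet W hne j) (cyclicGet I hIne j).1 (cyclicGet I hIne j).2 := by
  obtain ⟨r, q, hr, rfl⟩ := exists_eq_natCast_add_mul_length hne j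
  have hr' : r < I.length := hI.length_eq ▸ hr
  rw [cyclicGet_natCast_add_mul hne hr, hI.length_eq, cyclicGet_natCast_add_mul hIne hr']
  exact hI.get hr hr'

lemma isArcChain_reshuffle (h : IsRigid σ) (hW : IsClosedPath σ W) (hne : W ≠ []) (hIne : I ≠ [])
    (hI : List.Forall₂ (fun E p => IsEdgeArc σ E p.1 p.2) W I) :
    IsArcChain σ (cyclicGet W hne) (fun j => (cyclicGet I hIne j).1) (breakpoint I)
      (fun s => (reshuffle (fun x => (σ x).1) I s, reshuffle (fun x => (σ x).2) I s)) := by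
  have harc := isEdgeArc_cyclicGet hne hIne hI
  have hlt : ∀ p ∈ I, p.1 < p.2 := fun p hp => by
    obtain ⟨j, rfl⟩ := (range_cyclicGet hIne).ge hp
    exact (harc j).lt
  have hsub := isSubdivision_breakpoint hIne hlt
  refine ⟨hsub, breakpoint_zero I, fun j => ?_, fun j s hs => ?_⟩
  · rw [breakpoint_succ hIne, add_sub_cancel_left, add_sub_cancel]
    exact harc j
  rcases hs.2.lt_or_eq with hlt' | rfl
  · simp only [reshuffle_eq _ hIne hlt ⟨hs.1, hlt'⟩]
  · simp only [reshuffle_eq _ hIne hlt (left_mem_Ico.2 (hsub.lt_succ (j + 1))), sub_self, add_zero]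
    rw [breakpoint_succ hIne, add_sub_cancel_left, add_sub_cancel]
    exact ((hW.follows_cyclicGet hne j).apply_eq h (harc j) (harc (j + 1))).symm

end ClosedPaths

section Primitives

variable {F : Type*} [NormedAddCommGroup F] [NormedSpace ℝ F] {f : ℝ → F}

lemma intervalIntegral_zero_add (hf : Continuous f) (p s : ℝ) :
    ∫ x in (0 : ℝ)..s + p, f x = (∫ x in (0 : ℝ)..p, f x) + ∫ x in (0 : ℝ)..s, f (x + p) := by
  rw [intervalIntegral.integral_comp_add_right f p, zero_add,
    intervalIntegral.integral_add_adjacent_intervals (hf.intervalIntegrable 0 p)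
      (hf.intervalIntegrable p (s + p))]

lemma contDiff_primitive [CompleteSpace F] {n : ℕ} (hf : ContDiff ℝ n f) :
    ContDiff ℝ (n + 1) fun s => ∫ x in (0 : ℝ)..s, f x := by
  have hderiv : ∀ s, HasDerivAt (fun s => ∫ x in (0 : ℝ)..s, f x) (f s) s := fun s =>
    (hf.continuous.integral_hasStrictDerivAt 0 s).hasDerivAt
  rw [contDiff_succ_iff_deriv, funext fun s => (hderiv s).deriv]
  exact ⟨fun s => (hderiv s).differentiableAt, by simp, hf⟩

end Primitives

section CurveOfCurvature

/-- The tangent angle `η` of `curveOfCurvature κ`. -/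
noncomputable def tangentAngle (κ : ℝ → ℝ) (s : ℝ) : ℝ := ∫ x in (0 : ℝ)..s, κ x

/-- The unit tangent vector `(cos η, sin η)` of `curveOfCurvature κ`. -/
noncomputable def unitTangent (κ : ℝ → ℝ) (s : ℝ) : ℂ :=
  Complex.exp ((tangentAngle κ s : ℂ) * Complex.I)

variable {κ : ℝ → ℝ} {p : ℝ}

lemma tangentAngle_zero : tangentAngle κ 0 = 0 := intervalIntegral.integral_same

lemma unitTangent_zero : unitTangent κ 0 = 1 := by simp [unitTangent, tangentAngle_zero]

lemma curveOfCurvature_zero : curveOfCurvature κ 0 = 0 := intervalIntegral.integral_same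

lemma norm_unitTangent (s : ℝ) : ‖unitTangent κ s‖ = 1 := Complex.norm_exp_ofReal_mul_I _

lemma hasDerivAt_tangentAngle (hκ : Continuous κ) (s : ℝ) : HasDerivAt (tangentAngle κ) (κ s) s :=
  (hκ.integral_hasStrictDerivAt 0 s).hasDerivAt

lemma continuous_tangentAngle (hκ : Continuous κ) : Continuous (tangentAngle κ) :=
  continuous_iff_continuousAt.2 fun s => (hasDerivAt_tangentAngle hκ s).continuousAt

lemma hasDerivAt_unitTangent (hκ : Continuous κ) (s : ℝ) :
    HasDerivAt (unitTangent κ) (unitTangent κ s * (κ s * Complex.I)) s :=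
  ((hasDerivAt_tangentAngle hκ s).ofReal_comp.mul_const Complex.I).cexp

lemma continuous_unitTangent (hκ : Continuous κ) : Continuous (unitTangent κ) :=
  continuous_iff_continuousAt.2 fun s => (hasDerivAt_unitTangent hκ s).continuousAt

lemma hasDerivAt_curveOfCurvature (hκ : Continuous κ) (s : ℝ) :
    HasDerivAt (curveOfCurvature κ) (unitTangent κ s) s :=
  ((continuous_unitTangent hκ).integral_hasStrictDerivAt 0 s).hasDerivAt

lemma deriv_curveOfCurvature (hκ : Continuous κ) : deriv (curveOfCurvature κ) = unitTangent κ :=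
  funext fun s => (hasDerivAt_curveOfCurvature hκ s).deriv

lemma contDiff_curveOfCurvature {n : ℕ} (hκ : ContDiff ℝ n κ) :
    ContDiff ℝ (n + 1 + 1) (curveOfCurvature κ) := by
  have hangle : ContDiff ℝ (n + 1 : ℕ) (tangentAngle κ) := contDiff_primitive hκ
  exact_mod_cast contDiff_primitive
    ((Complex.ofRealCLM.contDiff.comp hangle).mul contDiff_const).cexp

lemma curvature_curveOfCurvature (hκ : Continuous κ) : curvature (curveOfCurvature κ) = κ := by
  funext s
  have hnorm : (unitTangent κ s).re * (unitTangent κ s).re +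
      (unitTangent κ s).im * (unitTangent κ s).im = 1 := by
    rw [← Complex.normSq_apply, Complex.normSq_eq_norm_sq, norm_unitTangent, one_pow]
  rw [curvature, deriv_curveOfCurvature hκ, (hasDerivAt_unitTangent hκ s).deriv, norm_unitTangent]
  simp only [Complex.mul_re, Complex.mul_im, Complex.ofReal_re, Complex.ofReal_im, Complex.I_re,
    Complex.I_im]
  linear_combination κ s * hnorm

lemma hasTurningNumber_curveOfCurvature (hκ : Continuous κ) {L : ℝ} {ξ : ℤ}
    (h : tangentAngle κ L = 2 * Real.pi * ξ) : HasTurningNumber (curveOfCurvature κ) L ξ := by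
  refine ⟨tangentAngle κ, continuous_tangentAngle hκ, fun s => ?_, ?_⟩
  · rw [deriv_curveOfCurvature hκ, norm_unitTangent, Complex.ofReal_one, one_mul, unitTangent]
  · rw [tangentAngle_zero, sub_zero, h]

lemma tangentAngle_add (hκ : Continuous κ) (hp : Function.Periodic κ p) (s : ℝ) :
    tangentAngle κ (s + p) = tangentAngle κ p + tangentAngle κ s := by
  simp only [tangentAngle, intervalIntegral_zero_add hκ, hp _]

lemma tangentAngle_int_mul (hκ : Continuous κ) (hp : Function.Periodic κ p) (k : ℤ) :
    tangentAngle κ (k * p) = k * tangentAngle κ p := by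
  have hper : Function.Periodic (fun k : ℤ => tangentAngle κ (k * p) - k * tangentAngle κ p) 1 :=
    fun k => by
      push_cast
      rw [add_mul, one_mul, tangentAngle_add hκ hp]
      ring
  simpa [tangentAngle_zero, sub_eq_zero] using eq_apply_zero_of_periodic_one hper k

lemma unitTangent_add (hκ : Continuous κ) (hp : Function.Periodic κ p) (s : ℝ) :
    unitTangent κ (s + p) = unitTangent κ p * unitTangent κ s := by
  simp only [unitTangent, tangentAngle_add hκ hp, ← Complex.exp_add, Complex.ofReal_add, add_mul]

lemma unitTangent_int_mul (hκ : Continuous κ) (hp : Function.Periodic κ p) (k : ℤ) :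
    unitTangent κ (k * p) = unitTangent κ p ^ k := by
  simp only [unitTangent, tangentAngle_int_mul hκ hp, ← Complex.exp_int_mul, Complex.ofReal_mul,
    Complex.ofReal_intCast, mul_assoc]

lemma curveOfCurvature_add (hκ : Continuous κ) (hp : Function.Periodic κ p) (s : ℝ) :
    curveOfCurvature κ (s + p) =
      unitTangent κ p * curveOfCurvature κ s + curveOfCurvature κ p := by
  have hint : ∀ s, curveOfCurvature κ s = ∫ x in (0 : ℝ)..s, unitTangent κ x := fun s => rfl
  simp only [hint, intervalIntegral_zero_add (continuous_unitTangent hκ), unitTangent_add hκ hp,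
    intervalIntegral.integral_const_mul]
  ring

lemma periodic_of_se2Act_curveOfCurvature (hκ : Continuous κ) {g : Circle × ℂ}
    (h : ∀ s, se2Act g (curveOfCurvature κ s) = curveOfCurvature κ (s + p)) :
    Function.Periodic κ p ∧ (g.1 : ℂ) = unitTangent κ p ∧ g.2 = curveOfCurvature κ p := by
  have htangent : ∀ s, (g.1 : ℂ) * unitTangent κ s = unitTangent κ (s + p) := fun s => by
    have hshift := (hasDerivAt_curveOfCurvature hκ (s + p)).comp_add_const s p
    rw [← funext h] at hshift
    exact (((hasDerivAt_curveOfCurvature hκ s).const_mul (g.1 : ℂ)).add_const g.2).unique hshift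
  refine ⟨fun s => ?_, ?_, ?_⟩
  · have hshift := (hasDerivAt_unitTangent hκ (s + p)).comp_add_const s p
    rw [← funext htangent] at hshift
    have hderiv := ((hasDerivAt_unitTangent hκ s).const_mul (g.1 : ℂ)).unique hshift
    rw [← htangent, ← mul_assoc] at hderiv
    have hne : (g.1 : ℂ) * unitTangent κ s ≠ 0 :=
      mul_ne_zero (Circle.coe_ne_zero _) (Complex.exp_ne_zero _)
    exact_mod_cast (mul_right_cancel₀ Complex.I_ne_zero (mul_left_cancel₀ hne hderiv)).symm
  · simpa [unitTangent_zero] using htangent 0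
  · simpa [curveOfCurvature_zero, se2Act] using h 0

/-- The direct isometry that shifts the parameter of `curveOfCurvature κ` by a period `p`
of `κ`. -/
noncomputable def shiftSymmetry (κ : ℝ → ℝ) (p : ℝ) : Circle × ℂ :=
  (Circle.exp (tangentAngle κ p), curveOfCurvature κ p)

lemma coe_fst_shiftSymmetry (κ : ℝ → ℝ) (p : ℝ) :
    ((shiftSymmetry κ p).1 : ℂ) = unitTangent κ p :=
  Circle.coe_exp _

lemma setOf_se2Act_curveOfCurvature (hκ : Continuous κ) :
    {g : Circle × ℂ | ∃ p, ∀ s,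
      se2Act g (curveOfCurvature κ s) = curveOfCurvature κ (s + p)} =
      shiftSymmetry κ '' {p | Function.Periodic κ p} := by
  ext g
  constructor
  · rintro ⟨p, hg⟩
    obtain ⟨hp, hrotation, htranslation⟩ := periodic_of_se2Act_curveOfCurvature hκ hg
    exact ⟨p, hp, Prod.ext (Circle.ext ((coe_fst_shiftSymmetry κ p).trans hrotation.symm))
      htranslation.symm⟩
  · rintro ⟨p, hp, rfl⟩
    refine ⟨p, fun s => ?_⟩
    rw [curveOfCurvature_add hκ hp, se2Act, coe_fst_shiftSymmetry]
    rfl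

end CurveOfCurvature

section SymmetricCurvature

lemma encard_range_of_eq_iff_modEq {β : Type*} {m : ℕ} [NeZero m] {f : ℤ → β}
    (hf : ∀ i j, f i = f j ↔ i ≡ j [ZMOD m]) : (range f).encard = m := by
  have hrange : range f = range fun x : ZMod m => f x.cast := by
    refine Subset.antisymm ?_ (range_subset_iff.2 fun x => mem_range_self _)
    rintro _ ⟨i, rfl⟩
    refine ⟨i, (hf _ _).2 ((ZMod.intCast_eq_intCast_iff _ _ m).1 ?_)⟩
    rw [ZMod.intCast_zmod_cast]
  have hinj : Function.Injective fun x : ZMod m => f x.cast := fun x y hxy => by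
    simpa only [ZMod.intCast_zmod_cast] using (ZMod.intCast_eq_intCast_iff _ _ m).2 ((hf _ _).1 hxy)
  rw [hrange, ← image_univ, hinj.encard_image, encard_univ, ENat.card_eq_coe_natCard, Nat.card_zmod]

lemma isPrimitiveRoot_unitTangent {κ : ℝ → ℝ} {ℓ : ℝ} {m : ℕ} {ξ : ℤ} (hκ : Continuous κ)
    (hℓ : Function.Periodic κ ℓ) (hm : m ≠ 0) (hcoprime : IsCoprime (m : ℤ) ξ)
    (hangle : tangentAngle κ (m * ℓ) = 2 * Real.pi * ξ) : IsPrimitiveRoot (unitTangent κ ℓ) m := by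
  have hm' : (m : ℝ) ≠ 0 := Nat.cast_ne_zero.2 hm
  have hstep : tangentAngle κ ℓ = 2 * Real.pi * (ξ / m) := by
    have hmul := tangentAngle_int_mul hκ hℓ m
    rw [Int.cast_natCast, hangle] at hmul
    field_simp
    linarith
  convert Complex.isPrimitiveRoot_exp_of_isCoprime ξ m hm hcoprime.symm using 1
  rw [unitTangent, hstep]
  push_cast
  ring_nf

/-- A curvature function with group of periods `ℤℓ`, along a period of which the tangent turns by
a primitive `m`-th root of unity, `m > 1`. These are the conditions under which
`curveOfCurvature κ` closes up after `m` periods of `κ`. -/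
structure IsSymmetricCurvature (κ : ℝ → ℝ) (ℓ : ℝ) (m : ℕ) : Prop where
  continuous : Continuous κ
  pos : 0 < ℓ
  periodic_iff : ∀ p, Function.Periodic κ p ↔ ∃ k : ℤ, k * ℓ = p
  one_lt : 1 < m
  isPrimitiveRoot : IsPrimitiveRoot (unitTangent κ ℓ) m

namespace IsSymmetricCurvature

variable {κ : ℝ → ℝ} {ℓ : ℝ} {m : ℕ}

lemma periodic_int_mul (h : IsSymmetricCurvature κ ℓ m) (k : ℤ) :
    Function.Periodic κ (k * ℓ) := (h.periodic_iff _).2 ⟨k, rfl⟩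

lemma periodic (h : IsSymmetricCurvature κ ℓ m) : Function.Periodic κ ℓ := by
  simpa using h.periodic_int_mul 1

lemma period_pos (h : IsSymmetricCurvature κ ℓ m) : 0 < (m : ℝ) * ℓ :=
  mul_pos (mod_cast zero_lt_one.trans h.one_lt) h.pos

lemma unitTangent_int_mul_eq_iff (h : IsSymmetricCurvature κ ℓ m) (i j : ℤ) :
    unitTangent κ (i * ℓ) = unitTangent κ (j * ℓ) ↔ i ≡ j [ZMOD m] := by
  have hne : unitTangent κ ℓ ≠ 0 := Complex.exp_ne_zero _
  rw [unitTangent_int_mul h.continuous h.periodic, unitTangent_int_mul h.continuous h.periodic,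
    eq_comm, ← div_eq_one_iff_eq (zpow_ne_zero i hne), ← zpow_sub₀ hne,
    h.isPrimitiveRoot.zpow_eq_one_iff_dvd, Int.modEq_iff_dvd]

lemma curve_periodic (h : IsSymmetricCurvature κ ℓ m) :
    Function.Periodic (curveOfCurvature κ) (m * ℓ) := by
  have hper : Function.Periodic κ (m * ℓ) := mod_cast h.periodic_int_mul m
  have htangent : unitTangent κ (m * ℓ) = 1 := by
    have hpow := unitTangent_int_mul h.continuous h.periodic m
    rwa [zpow_natCast, h.isPrimitiveRoot.pow_eq_one, Int.cast_natCast] at hpow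
  -- The translation by `curveOfCurvature κ (m * ℓ)` commutes with a nontrivial rotation.
  have hclosed : curveOfCurvature κ (m * ℓ) = 0 := by
    have hfirst := curveOfCurvature_add h.continuous h.periodic (m * ℓ)
    have hlast := curveOfCurvature_add h.continuous hper ℓ
    rw [add_comm ℓ, hfirst, htangent] at hlast
    have hzero : (unitTangent κ ℓ - 1) * curveOfCurvature κ (m * ℓ) = 0 := by
      linear_combination hlast
    exact (mul_eq_zero.1 hzero).resolve_left (sub_ne_zero.2 (h.isPrimitiveRoot.ne_one h.one_lt))
  intro s
  rw [curveOfCurvature_add h.continuous hper, htangent, hclosed, one_mul, add_zero]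

lemma exists_of_curve_periodic (h : IsSymmetricCurvature κ ℓ m) {p : ℝ}
    (hp : Function.Periodic (curveOfCurvature κ) p) : ∃ k : ℤ, k * (m * ℓ) = p := by
  obtain ⟨hκp, htangent, -⟩ := periodic_of_se2Act_curveOfCurvature h.continuous (g := (1, 0))
    (p := p) fun s => by simp [hp s, se2Act]
  obtain ⟨k, rfl⟩ := (h.periodic_iff p).1 hκp
  obtain ⟨q, rfl⟩ : (m : ℤ) ∣ k := by
    refine (Int.modEq_zero_iff_dvd).1 ((h.unitTangent_int_mul_eq_iff k 0).1 ?_)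
    rw [← htangent, Int.cast_zero, zero_mul, unitTangent_zero, Circle.coe_one]
  exact ⟨q, by push_cast; ring⟩

lemma isClosedCurve (h : IsSymmetricCurvature κ ℓ m) (hκ : ContDiff ℝ 1 κ) :
    IsClosedCurve (curveOfCurvature κ) (m * ℓ) := by
  refine ⟨?_, fun s => ?_, ⟨h.period_pos, h.curve_periodic⟩, ?_⟩
  · have hcurve : ContDiff ℝ ((1 : ℕ) + 1 + 1) (curveOfCurvature κ) :=
      contDiff_curveOfCurvature (mod_cast hκ)
    exact hcurve.of_le (by norm_num)
  · rw [deriv_curveOfCurvature h.continuous, norm_unitTangent]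
  · rintro p ⟨hp0, hp⟩
    obtain ⟨k, rfl⟩ := h.exists_of_curve_periodic hp
    have hk : 0 < k := Int.cast_pos.1 ((pos_iff_pos_of_mul_pos hp0).2 h.period_pos)
    exact le_mul_of_one_le_left h.period_pos.le (mod_cast hk)

lemma shiftSymmetry_int_mul_eq_iff (h : IsSymmetricCurvature κ ℓ m) (i j : ℤ) :
    shiftSymmetry κ (i * ℓ) = shiftSymmetry κ (j * ℓ) ↔ i ≡ j [ZMOD m] := by
  rw [← h.unitTangent_int_mul_eq_iff, ← coe_fst_shiftSymmetry, ← coe_fst_shiftSymmetry,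
    Circle.coe_inj]
  refine ⟨congrArg Prod.fst, fun hfst => Prod.ext hfst ?_⟩
  rw [← Circle.coe_inj, coe_fst_shiftSymmetry, coe_fst_shiftSymmetry,
    h.unitTangent_int_mul_eq_iff, Int.modEq_iff_add_fac] at hfst
  obtain ⟨q, rfl⟩ := hfst
  have hshift := h.curve_periodic.int_mul q (i * ℓ)
  simp only [shiftSymmetry]
  rw [← hshift]
  congr 1
  push_cast
  ring

lemma paramSymIndex_eq (h : IsSymmetricCurvature κ ℓ m) :
    paramSymIndex (curveOfCurvature κ) = m := by
  have hm : NeZero m := ⟨(zero_lt_one.trans h.one_lt).ne'⟩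
  have hperiods : {p | Function.Periodic κ p} = range fun k : ℤ => k * ℓ := ext h.periodic_iff
  rw [paramSymIndex, setOf_se2Act_curveOfCurvature h.continuous, hperiods, ← range_comp]
  exact encard_range_of_eq_iff_modEq h.shiftSymmetry_int_mul_eq_iff

end IsSymmetricCurvature

end SymmetricCurvature

section UnitSpeed

open scoped RealInnerProductSpace

/-- A continuously differentiable curve parameterized by arc-length. For `E = ℝ` these are the
maps `s ↦ p ± s`. -/
structure IsUnitSpeed {E : Type*} [NormedAddCommGroup E] [NormedSpace ℝ E] (α : ℝ → E) :
    Prop where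
  contDiff : ContDiff ℝ 1 α
  norm_deriv : ∀ s, ‖deriv α s‖ = 1

namespace IsUnitSpeed

section NormedSpace

variable {E : Type*} [NormedAddCommGroup E] [NormedSpace ℝ E] {α : ℝ → E}

lemma hasDerivAt (hα : IsUnitSpeed α) (s : ℝ) : HasDerivAt α (deriv α s) s :=
  (hα.contDiff.differentiable_one s).hasDerivAt

lemma deriv_ne_zero (hα : IsUnitSpeed α) (s : ℝ) : deriv α s ≠ 0 := fun h => by
  simpa [h] using hα.norm_deriv s

lemma comp (hα : IsUnitSpeed α) {φ : ℝ → ℝ} (hφ : IsUnitSpeed φ) : IsUnitSpeed (α ∘ φ) where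
  contDiff := hα.contDiff.comp hφ.contDiff
  norm_deriv s := by
    rw [((hα.hasDerivAt (φ s)).scomp s (hφ.hasDerivAt s)).deriv, norm_smul, hφ.norm_deriv,
      hα.norm_deriv, mul_one]

end NormedSpace

end IsUnitSpeed

lemma eventually_eq_of_abs_eq_one {X : Type*} [TopologicalSpace X] {ψ : X → ℝ} {t : X}
    (hψ : ContinuousAt ψ t) (habs : ∀ᶠ s in 𝓝 t, |ψ s| = 1) : ∀ᶠ s in 𝓝 t, ψ s = ψ t := by
  filter_upwards [habs, hψ.eventually (Ioo_mem_nhds (sub_one_lt _) (lt_add_one _))]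
    with s hs ⟨hlt, hgt⟩
  rcases (abs_eq zero_le_one).1 hs with hs | hs <;>
    rcases (abs_eq zero_le_one).1 habs.self_of_nhds with ht | ht <;> linarith

lemma hasDerivAt_add_mul_sub (p c t s : ℝ) : HasDerivAt (fun s => p + c * (s - t)) c s := by
  simpa using (((hasDerivAt_id s).sub_const t).const_mul c).const_add p

lemma isUnitSpeed_add_mul_sub (p t : ℝ) {c : ℝ} (hc : |c| = 1) :
    IsUnitSpeed fun s => p + c * (s - t) where
  contDiff := by fun_prop
  norm_deriv s := by rw [(hasDerivAt_add_mul_sub p c t s).deriv, Real.norm_eq_abs, hc]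

namespace IsUnitSpeed

variable {E : Type*} [NormedAddCommGroup E] [InnerProductSpace ℝ E] {α β : ℝ → E} {Γ : Set E}
  {t t' : ℝ}

lemma hasDerivAt_inner (hα : IsUnitSpeed α) (v : E) (s : ℝ) :
    HasDerivAt (fun s => ⟪v, α s⟫) ⟪v, deriv α s⟫ s := by
  simpa using (hasDerivAt_const s v).inner ℝ (hα.hasDerivAt s)

lemma continuous_inner_deriv (hα : IsUnitSpeed α) (v : E) :
    Continuous fun s => ⟪v, deriv α s⟫ :=
  continuous_const.inner hα.contDiff.continuous_deriv_one

lemma exists_mem_nhds_injOn (hα : IsUnitSpeed α) (t : ℝ) :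
    ∃ U ∈ 𝓝 t, InjOn α U ∧ ∀ s ∈ U, ⟪deriv α t, deriv α s⟫ ≠ 0 := by
  have hself : 0 < ⟪deriv α t, deriv α t⟫ := by simp [hα.norm_deriv]
  obtain ⟨ε, hε, hball⟩ := Metric.eventually_nhds_iff_ball.1
    ((hα.continuous_inner_deriv _).continuousAt.eventually_const_lt hself)
  refine ⟨Metric.ball t ε, Metric.ball_mem_nhds t hε, ?_, fun s hs => (hball s hs).ne'⟩
  have hmono : StrictMonoOn (fun s => ⟪deriv α t, α s⟫) (Metric.ball t ε) := by
    refine strictMonoOn_of_deriv_pos (convex_ball t ε)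
      (continuous_const.inner hα.contDiff.continuous).continuousOn fun s hs => ?_
    rw [(hα.hasDerivAt_inner _ s).deriv]
    exact hball s (interior_subset hs)
  exact fun x hx y hy hxy => hmono.injOn hx hy (congrArg (fun z => ⟪deriv α t, z⟫) hxy)

lemma exists_eventually_eq_add_mul_sub (hα : IsUnitSpeed α) (hαΓ : ∀ s, α s ∈ Γ)
    (hβ : IsUnitSpeed β) (hβΓ : ∀ s, β s ∈ Γ) (hp : IsSimplePoint Γ (β t')) (htt' : α t = β t') :
    ∃ c : ℝ, |c| = 1 ∧ ∀ᶠ s in 𝓝 t, α s = β (t' + c * (s - t)) := by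
  obtain ⟨U, hU, hinj, hne⟩ := hβ.exists_mem_nhds_injOn t'
  obtain ⟨φ, hφt, hφ, hcomp⟩ := hp.exists_local_reparametrization hα.contDiff.continuous hαΓ
    hβ.contDiff.continuous hβΓ htt' hU hinj
  set v := deriv β t'
  set ψ : ℝ → ℝ := fun s => ⟪v, deriv α s⟫ / ⟪v, deriv β (φ s)⟫
  have hderiv : ∀ᶠ s in 𝓝 t, HasDerivAt φ (ψ s) s := by
    filter_upwards [hφ, hcomp, eventually_eventually_nhds.2 hcomp] with s hφs hs hcomps
    exact hasDerivAt_of_comp_eventuallyEq hφs (hβ.hasDerivAt_inner v (φ s)) (hne _ hs.1)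
      (hα.hasDerivAt_inner v s) (hcomps.mono fun x hx => congrArg (fun z => ⟪v, z⟫) hx.2)
  have habs : ∀ᶠ s in 𝓝 t, |ψ s| = 1 := by
    filter_upwards [hderiv, eventually_eventually_nhds.2 hcomp] with s hs hcomps
    have hα' := ((hβ.hasDerivAt (φ s)).scomp s hs).congr_of_eventuallyEq
      (hcomps.mono fun x hx => hx.2.symm)
    have hnorm := hα.norm_deriv s
    rwa [hα'.deriv, norm_smul, hβ.norm_deriv, mul_one, Real.norm_eq_abs] at hnorm
  have hψ : ContinuousAt ψ t := (hα.continuous_inner_deriv v).continuousAt.div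
    ((hβ.continuous_inner_deriv v).continuousAt.comp hφ.self_of_nhds)
    (hne _ hcomp.self_of_nhds.1)
  have hφ' : ∀ᶠ s in 𝓝[≠] t, HasDerivAt φ (ψ t) s :=
    nhdsWithin_le_nhds <| (hderiv.and (eventually_eq_of_abs_eq_one hψ habs)).mono
      fun s hs => hs.2 ▸ hs.1
  refine ⟨ψ t, habs.self_of_nhds, ?_⟩
  filter_upwards [hcomp, eventually_eq_add_mul_of_hasDerivAt hφ hφ'] with s hs hlin
  rw [← hs.2, hlin, hφt]

lemma eq_of_deriv_eq (hα : IsUnitSpeed α) (hαΓ : ∀ s, α s ∈ Γ) (hβ : IsUnitSpeed β)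
    (hβΓ : ∀ s, β s ∈ Γ) (hΓ : IsSimple Γ) (ht : α t = β t) (ht' : deriv α t = deriv β t) :
    α = β := by
  set A : Set ℝ := {s | α s = β s ∧ deriv α s = deriv β s}
  have hclosed : IsClosed A :=
    (isClosed_eq hα.contDiff.continuous hβ.contDiff.continuous).inter
      (isClosed_eq hα.contDiff.continuous_deriv_one hβ.contDiff.continuous_deriv_one)
  have hopen : IsOpen A := by
    rw [isOpen_iff_mem_nhds]
    rintro x ⟨hx, hx'⟩
    obtain ⟨c, -, hc⟩ := hα.exists_eventually_eq_add_mul_sub hαΓ hβ hβΓ (hΓ _ (hβΓ x)) hx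
    have hc1 : c = 1 := by
      have hderiv := (HasDerivAt.scomp_of_eq x (hβ.hasDerivAt x) (hasDerivAt_add_mul_sub x c x x)
        (by simp)).congr_of_eventuallyEq hc
      rw [hderiv.deriv] at hx'
      exact smul_left_injective ℝ (hβ.deriv_ne_zero x) (hx'.trans (one_smul ℝ _).symm)
    have heq : α =ᶠ[𝓝 x] β := hc.mono fun s hs => by rw [hs, hc1, one_mul, add_sub_cancel]
    filter_upwards [heq, heq.deriv] with s hs hs' using ⟨hs, hs'⟩
  have huniv : A = univ := IsClopen.eq_univ ⟨hclosed, hopen⟩ ⟨t, ht, ht'⟩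
  exact funext fun s => (huniv.ge (mem_univ s)).1

lemma exists_eq_add_mul_sub (hα : IsUnitSpeed α) (hαΓ : ∀ s, α s ∈ Γ) (hβ : IsUnitSpeed β)
    (hβΓ : ∀ s, β s ∈ Γ) (hΓ : IsSimple Γ) (htt' : α t = β t') :
    ∃ c : ℝ, |c| = 1 ∧ ∀ s, α s = β (t' + c * (s - t)) := by
  obtain ⟨c, hc, hlocal⟩ :=
    hα.exists_eventually_eq_add_mul_sub hαΓ hβ hβΓ (hΓ _ (hβΓ t')) htt'
  exact ⟨c, hc, congrFun <| hα.eq_of_deriv_eq hαΓ (hβ.comp (isUnitSpeed_add_mul_sub t' t hc))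
    (fun s => hβΓ _) hΓ hlocal.self_of_nhds (Filter.EventuallyEq.deriv_eq hlocal)⟩

lemma periodic_of_eq (hα : IsUnitSpeed α) (hsimple : IsSimple (range α)) (htt' : α t = α t') :
    Function.Periodic α (t' - t) := by
  obtain ⟨c, hc, heq⟩ :=
    hα.exists_eq_add_mul_sub mem_range_self hα mem_range_self hsimple htt'
  rcases (abs_eq zero_le_one).1 hc with rfl | rfl
  · intro s
    rw [heq s]
    ring_nf
  · -- A curve that equals its own reversal would have to stop at the midpoint.
    have hreversal : HasDerivAt α ((-1 : ℝ) • deriv α ((t + t') / 2)) ((t + t') / 2) :=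
      (HasDerivAt.scomp_of_eq _ (hα.hasDerivAt ((t + t') / 2)) (hasDerivAt_add_mul_sub t' (-1) t _)
        (by ring)).congr_of_eventuallyEq (Filter.Eventually.of_forall heq)
    have hspeed := (hreversal.unique (hα.hasDerivAt _)).trans (one_smul ℝ _).symm
    exact absurd (smul_left_injective ℝ (hα.deriv_ne_zero _) hspeed) (by norm_num)

end IsUnitSpeed

end UnitSpeed

section SimpleCurves

variable {α : ℝ → ℂ} {L : ℝ}

lemma IsUnitSpeed.hasDerivAt_se2Act (hα : IsUnitSpeed α) (g : Circle × ℂ) (s : ℝ) :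
    HasDerivAt (fun s => se2Act g (α s)) ((g.1 : ℂ) * deriv α s) s :=
  ((hα.hasDerivAt s).const_mul (g.1 : ℂ)).add_const g.2

lemma IsUnitSpeed.se2Act_comp (hα : IsUnitSpeed α) (g : Circle × ℂ) :
    IsUnitSpeed fun s => se2Act g (α s) where
  contDiff := (contDiff_const.mul hα.contDiff).add contDiff_const
  norm_deriv s := by
    rw [(hα.hasDerivAt_se2Act g s).deriv, norm_mul, Circle.norm_coe, hα.norm_deriv, one_mul]

lemma isUnitSpeed_add_const (c : ℝ) : IsUnitSpeed fun s : ℝ => s + c := by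
  simpa [add_comm c] using isUnitSpeed_add_mul_sub c 0 abs_one

lemma IsUnitSpeed.symIndex_eq (hα : IsUnitSpeed α) (hsimple : IsSimple (range α)) :
    symIndex α = paramSymIndex α := by
  unfold symIndex paramSymIndex
  congr 1
  ext g
  constructor
  · rintro ⟨hpoints, horiented⟩
    obtain ⟨c, hc⟩ : (se2Act g (α 0), (g.1 : ℂ) * deriv α 0) ∈
        range fun s => (α s, deriv α s) :=
      horiented.subset ⟨_, mem_range_self 0, rfl⟩
    obtain ⟨hpoint, htangent⟩ := Prod.mk.inj hc
    refine ⟨c, congrFun <| (hα.se2Act_comp g).eq_of_deriv_eq (t := 0)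
      (fun s => hpoints.subset (mem_image_of_mem _ (mem_range_self s)))
      (hα.comp (isUnitSpeed_add_const c)) (fun s => mem_range_self _) hsimple ?_ ?_⟩
    · rw [zero_add, hpoint]
    · rw [(hα.hasDerivAt_se2Act g 0).deriv, deriv_comp_add_const, zero_add, htangent]
  · rintro ⟨c, hc⟩
    have htangent (s : ℝ) : (g.1 : ℂ) * deriv α s = deriv α (s + c) := by
      rw [← (hα.hasDerivAt_se2Act g s).deriv, funext hc, deriv_comp_add_const]
    constructor <;> rw [← range_comp]
    · exact (congrArg range (funext hc)).trans ((Equiv.addRight c).surjective.range_comp α)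
    · exact (congrArg range (funext fun s => Prod.ext (hc s) (htangent s))).trans
        ((Equiv.addRight c).surjective.range_comp fun s => (α s, deriv α s))

lemma periodic_deriv {F : Type*} [NormedAddCommGroup F] [NormedSpace ℝ F] {f : ℝ → F} {p : ℝ}
    (hf : Function.Periodic f p) : Function.Periodic (deriv f) p := fun s => by
  rw [← deriv_comp_add_const, hf.funext]

lemma periodic_signatureMap {p : ℝ} (hα : Function.Periodic α p) :
    Function.Periodic (signatureMap α) p := by
  have hderiv := periodic_deriv hα
  have hcurvature : Function.Periodic (curvature α) p := fun s => by
    simp only [curvature, hderiv s, periodic_deriv hderiv s]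
  intro s
  simp only [signatureMap, curvatureDot, hcurvature s, periodic_deriv hcurvature s, hderiv s]

lemma IsClosedCurve.isUnitSpeed (hα : IsClosedCurve α L) : IsUnitSpeed α where
  contDiff := hα.contDiff.of_le (by norm_num)
  norm_deriv := hα.unit_speed

lemma IsClosedCurve.injOn_Ico (hα : IsClosedCurve α L) (hsimple : IsSimple (range α)) :
    InjOn α (Ico 0 L) := by
  intro x hx y hy hxy
  by_contra! hne
  wlog hlt : x < y generalizing x y
  · exact this hy hx hxy.symm hne.symm (hne.symm.lt_of_le (not_lt.1 hlt))
  have hle := hα.minimal_period.2 ⟨sub_pos.2 hlt, hα.isUnitSpeed.periodic_of_eq hsimple hxy⟩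
  linarith [hx.1, hy.2]

lemma IsClosedCurve.sigIndex_eq (hα : IsClosedCurve α L) (hsimple : IsSimple (range α)) :
    sigIndex α = paramSigIndex α L := by
  obtain ⟨hL, hper⟩ := hα.minimal_period.1
  have himage (ζ : ℝ × ℝ) : α '' {u | signatureMap α u = ζ} =
      α '' {u | u ∈ Ico 0 L ∧ signatureMap α u = ζ} := by
    refine Subset.antisymm ?_ (image_mono fun u hu => hu.2)
    rintro _ ⟨u, rfl, rfl⟩
    have hboth : Function.Periodic (fun s => (α s, signatureMap α s)) L := fun s =>
      Prod.ext (hper s) (periodic_signatureMap hper s)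
    obtain ⟨v, hv, huv⟩ := hboth.exists_mem_Ico₀ hL u
    obtain ⟨hpoint, hsignature⟩ := Prod.mk.inj huv
    exact ⟨v, ⟨hv, hsignature.symm⟩, hpoint.symm⟩
  rw [sigIndex, paramSigIndex, iInf_range]
  refine iInf_congr fun t => ?_
  rw [himage, ((hα.injOn_Ico hsimple).mono fun u hu => hu.1).encard_image]

end SimpleCurves

section Signature

variable {γ : ℝ → ℂ}

lemma contDiff_curvature {n : ℕ} (hγ : ContDiff ℝ (n + 1 + 1) γ) (hreg : ∀ s, deriv γ s ≠ 0) :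
    ContDiff ℝ n (curvature γ) := by
  have hdd : ContDiff ℝ n (deriv (deriv γ)) := hγ.deriv'.deriv'
  have hd : ContDiff ℝ n (deriv γ) := hγ.deriv'.of_le le_self_add
  have hre {f : ℝ → ℂ} (hf : ContDiff ℝ n f) : ContDiff ℝ n fun s => (f s).re :=
    Complex.reCLM.contDiff.comp hf
  have him {f : ℝ → ℂ} (hf : ContDiff ℝ n f) : ContDiff ℝ n fun s => (f s).im :=
    Complex.imCLM.contDiff.comp hf
  exact (((hre hd).mul (him hdd)).sub ((him hd).mul (hre hdd))).div ((hd.norm ℝ hreg).pow 3)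
    fun s => pow_ne_zero 3 (norm_ne_zero_iff.2 (hreg s))

lemma IsUnitSpeed.curvatureDot_eq (hγ : IsUnitSpeed γ) : curvatureDot γ = deriv (curvature γ) :=
  funext fun s => by rw [curvatureDot, hγ.norm_deriv, div_one]

lemma IsUnitSpeed.signatureMap_eq (hγ : IsUnitSpeed γ) :
    signatureMap γ = fun s => (curvature γ s, deriv (curvature γ) s) := by
  rw [← hγ.curvatureDot_eq]
  rfl

lemma IsNondegenerate.eventually_curvatureDot_ne_zero (hnd : IsNondegenerate γ) {t : ℝ}
    (hγ : DifferentiableAt ℝ γ t) (hreg : deriv γ t ≠ 0) (hcont : ContinuousAt (curvatureDot γ) t) :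
    ∀ᶠ s in 𝓝[≠] t, curvatureDot γ s ≠ 0 := by
  by_cases hvertex : curvatureDot γ t = 0
  · obtain ⟨U, hU, hisolated⟩ := hnd (γ t) ⟨t, hvertex, rfl⟩
    filter_upwards [hγ.hasDerivAt.eventually_ne (c := γ t) hreg,
      nhdsWithin_le_nhds (hγ.continuousAt hU)] with s hne hsU hs
    exact hne (hisolated.subset ⟨⟨s, hs, rfl⟩, hsU⟩)
  · exact nhdsWithin_le_nhds (hcont.eventually_ne hvertex)

lemma IsNondegenerate.isRigid_signatureMap (hnd : IsNondegenerate γ) (hγ : IsUnitSpeed γ)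
    (hκ : ContDiff ℝ 1 (curvature γ)) : IsRigid (signatureMap γ) := by
  rw [hγ.signatureMap_eq]
  refine isRigid_prodMk_deriv hκ fun t => ?_
  rw [← hγ.curvatureDot_eq]
  refine hnd.eventually_curvatureDot_ne_zero (hγ.hasDerivAt t).differentiableAt
    (hγ.deriv_ne_zero t) ?_
  rw [hγ.curvatureDot_eq]
  exact hκ.continuous_deriv_one.continuousAt

end Signature

section ReshuffledCurvature

variable {σ : ℝ → ℝ × ℝ} {W : List (QuiverEdge (range σ))} {I : List (ℝ × ℝ)}

lemma IsClosedPath.ne_nil (hW : IsClosedPath σ W) : W ≠ [] := hW.2.fst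

lemma IsClosedPath.intervals_ne_nil (hW : IsClosedPath σ W)
    (hI : List.Forall₂ (fun E p => IsEdgeArc σ E p.1 p.2) W I) : I ≠ [] := by
  rintro rfl
  exact hW.ne_nil (List.forall₂_nil_right_iff.1 hI)

lemma IsClosedPath.hasDerivAt_reshuffle (h : IsRigid σ)
    (hσ : ∀ s, HasDerivAt (fun x => (σ x).1) (σ s).2 s) (hW : IsClosedPath σ W)
    (hI : List.Forall₂ (fun E p => IsEdgeArc σ E p.1 p.2) W I) (s : ℝ) :
    HasDerivAt (reshuffle (fun x => (σ x).1) I) (reshuffle (fun x => (σ x).2) I s) s :=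
  (isArcChain_reshuffle h hW hW.ne_nil (hW.intervals_ne_nil hI) hI).hasDerivAt_fst hσ s

lemma IsClosedPath.continuous_reshuffle (h : IsRigid σ) (hW : IsClosedPath σ W)
    (hI : List.Forall₂ (fun E p => IsEdgeArc σ E p.1 p.2) W I) :
    Continuous fun s => (reshuffle (fun x => (σ x).1) I s, reshuffle (fun x => (σ x).2) I s) :=
  (isArcChain_reshuffle h hW hW.ne_nil (hW.intervals_ne_nil hI) hI).continuous h.continuous

lemma IsClosedPath.deriv_reshuffle (h : IsRigid σ)
    (hσ : ∀ s, HasDerivAt (fun x => (σ x).1) (σ s).2 s) (hW : IsClosedPath σ W)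
    (hI : List.Forall₂ (fun E p => IsEdgeArc σ E p.1 p.2) W I) :
    deriv (reshuffle (fun x => (σ x).1) I) = reshuffle (fun x => (σ x).2) I :=
  funext fun s => (hW.hasDerivAt_reshuffle h hσ hI s).deriv

lemma IsClosedPath.contDiff_reshuffle (h : IsRigid σ)
    (hσ : ∀ s, HasDerivAt (fun x => (σ x).1) (σ s).2 s) (hW : IsClosedPath σ W)
    (hI : List.Forall₂ (fun E p => IsEdgeArc σ E p.1 p.2) W I) :
    ContDiff ℝ 1 (reshuffle (fun x => (σ x).1) I) := by
  rw [contDiff_one_iff_deriv, hW.deriv_reshuffle h hσ hI]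
  exact ⟨fun s => (hW.hasDerivAt_reshuffle h hσ hI s).differentiableAt,
    (hW.continuous_reshuffle h hI).snd⟩

lemma IsClosedPath.breakpoint_length_eq (hW : IsClosedPath σ W)
    (hI : List.Forall₂ (fun E p => IsEdgeArc σ E p.1 p.2) W I) :
    breakpoint I W.length = totalLength I := by
  rw [hI.length_eq, breakpoint_length (hW.intervals_ne_nil hI)]

lemma IsClosedPath.intervalIntegral_reshuffle (h : IsRigid σ) (hW : IsClosedPath σ W)
    (hI : List.Forall₂ (fun E p => IsEdgeArc σ E p.1 p.2) W I) {ω : QuiverEdge (range σ) → ℝ}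
    (hω : ∀ E, ∃ a b, IsEdgeArc σ E a b ∧ ω E = ∫ s in a..b, (σ s).1) :
    ∫ s in (0 : ℝ)..totalLength I, reshuffle (fun x => (σ x).1) I s =
      ∑ᶠ E, (multiplicity W E : ℝ) * ω E := by
  have hc := isArcChain_reshuffle h hW hW.ne_nil (hW.intervals_ne_nil hI) hI
  rw [← hW.breakpoint_length_eq hI,
    hc.intervalIntegral_eq_sum (hc.continuous h.continuous) continuous_fst, finsum_multiplicity_mul,
    Finset.sum_range, ← Fin.sum_univ_fun_getElem]
  refine Finset.sum_congr rfl fun r _ => ?_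
  obtain ⟨a, b, hab, hweight⟩ := hω W[r.1]
  have harc := hc.arc r
  rw [cyclicGet_natCast hW.ne_nil r.2] at harc
  rw [hweight]
  exact harc.intervalIntegral_eq h hab Prod.fst

lemma IsClosedPath.iInf_encard_reshuffle (h : IsRigid σ)
    (hσ : ∀ s, HasDerivAt (fun x => (σ x).1) (σ s).2 s) (hW : IsClosedPath σ W)
    (hI : List.Forall₂ (fun E p => IsEdgeArc σ E p.1 p.2) W I) {κ : ℝ → ℝ}
    (hκ : κ = reshuffle (fun x => (σ x).1) I) :
    ⨅ ζ ∈ range fun s => (κ s, deriv κ s),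
      {s | s ∈ Ico 0 (totalLength I) ∧ (κ s, deriv κ s) = ζ}.encard =
      ⨅ E ∈ W, (multiplicity W E : ℕ∞) := by
  rw [hκ, hW.deriv_reshuffle h hσ hI, ← hW.breakpoint_length_eq hI, ← iInf_encard_cyclicGet
    hW.ne_nil]
  exact (isArcChain_reshuffle h hW hW.ne_nil (hW.intervals_ne_nil hI) hI).iInf_encard_fiber h

end ReshuffledCurvature

section Powers

variable {σ : ℝ → ℝ × ℝ} {w : List (QuiverEdge (range σ))} {m : ℕ} {I : List (ℝ × ℝ)}

lemma IsClosedPath.isArcChain_wordPow (h : IsRigid σ) (hW : IsClosedPath σ (wordPow w m))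
    (hI : List.Forall₂ (fun E p => IsEdgeArc σ E p.1 p.2) (wordPow w m) I) :
    IsArcChain σ (cyclicGet w (ne_nil_of_wordPow_ne_nil hW.ne_nil))
      (fun j => (cyclicGet I (hW.intervals_ne_nil hI) j).1) (breakpoint I)
      (fun s => (reshuffle (fun x => (σ x).1) I s, reshuffle (fun x => (σ x).2) I s)) := by
  rw [← cyclicGet_wordPow _ hW.ne_nil]
  exact isArcChain_reshuffle h hW hW.ne_nil (hW.intervals_ne_nil hI) hI

lemma IsClosedPath.totalLength_wordPow (h : IsRigid σ) (hW : IsClosedPath σ (wordPow w m))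
    (hI : List.Forall₂ (fun E p => IsEdgeArc σ E p.1 p.2) (wordPow w m) I) :
    totalLength I = m * breakpoint I w.length := by
  rw [← hW.breakpoint_length_eq hI, length_wordPow, Nat.cast_mul,
    (hW.isArcChain_wordPow h hI).apply_mul_of_periodic h (cyclicGet_periodic _), Int.cast_natCast]

lemma IsClosedPath.periodic_reshuffle_iff (h : IsRigid σ)
    (hσ : ∀ s, HasDerivAt (fun x => (σ x).1) (σ s).2 s) (hw : ¬ IsPeriodicWord w)
    (hW : IsClosedPath σ (wordPow w m))
    (hI : List.Forall₂ (fun E p => IsEdgeArc σ E p.1 p.2) (wordPow w m) I) (p : ℝ) :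
    Function.Periodic (reshuffle (fun x => (σ x).1) I) p ↔
      ∃ k : ℤ, k * breakpoint I w.length = p := by
  have hwne := ne_nil_of_wordPow_ne_nil hW.ne_nil
  have hc := hW.isArcChain_wordPow h hI
  have hmul := hc.apply_mul_of_periodic h (cyclicGet_periodic hwne)
  constructor
  · intro hp
    have hpair : Function.Periodic
        (fun s => (reshuffle (fun x => (σ x).1) I s, reshuffle (fun x => (σ x).2) I s)) p := by
      rw [← hW.deriv_reshuffle h hσ hI]
      exact fun s => Prod.ext (hp s) (periodic_deriv hp s)
    obtain ⟨d, rfl, hd⟩ := hc.exists_periodic_of_periodic h hpair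
    obtain ⟨k, rfl⟩ := length_dvd_of_periodic_cyclicGet hwne hw hd
    exact ⟨k, by rw [mul_comm (w.length : ℤ), hmul]⟩
  · rintro ⟨k, rfl⟩ s
    rw [← hmul]
    exact congrArg Prod.fst (hc.periodic_apply h ((cyclicGet_periodic hwne).int_mul k) s)

lemma IsClosedPath.isSymmetricCurvature_reshuffle (h : IsRigid σ)
    (hσ : ∀ s, HasDerivAt (fun x => (σ x).1) (σ s).2 s) (hw : ¬ IsPeriodicWord w) (hm : 1 < m)
    (hW : IsClosedPath σ (wordPow w m))
    (hI : List.Forall₂ (fun E p => IsEdgeArc σ E p.1 p.2) (wordPow w m) I) {ξ : ℤ}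
    (hcoprime : IsCoprime (m : ℤ) ξ)
    (hangle : tangentAngle (reshuffle (fun x => (σ x).1) I) (totalLength I) =
      2 * Real.pi * ξ) :
    IsSymmetricCurvature (reshuffle (fun x => (σ x).1) I) (breakpoint I w.length) m := by
  have hcont := (hW.contDiff_reshuffle h hσ hI).continuous
  have hperiodic := hW.periodic_reshuffle_iff h hσ hw hI
  have hlength : (0 : ℤ) < w.length :=
    mod_cast List.length_pos_iff.2 (ne_nil_of_wordPow_ne_nil hW.ne_nil)
  rw [hW.totalLength_wordPow h hI] at hangle
  refine ⟨hcont, ?_, hperiodic, hm, isPrimitiveRoot_unitTangent hcont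
    ((hperiodic _).2 ⟨1, by simp⟩) (zero_lt_one.trans hm).ne' hcoprime hangle⟩
  simpa only [breakpoint_zero] using
    (hW.isArcChain_wordPow h hI).isSubdivision.strictMono hlength

end Powers

end SigCurve

theorem mainTheorem7_general {γ : ℝ → ℂ} (hγ : ContDiff ℝ 3 γ) (hunit : ∀ s, ‖deriv γ s‖ = 1)
    (hnd : IsNondegenerate γ) {ξ : ℤ} {ω : QuiverEdge (range (signatureMap γ)) → ℝ}
    (hω : ∀ E, IsWeight γ E (ω E)) {w : List (QuiverEdge (range (signatureMap γ)))} {m : ℕ}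
    (hw : ¬ IsPeriodicWord w) (hm : 1 < m) (hW : IsClosedPath (signatureMap γ) (wordPow w m))
    (hgcd : IsCoprime (m : ℤ) ξ) {I : List (ℝ × ℝ)}
    (hI : List.Forall₂ (fun E p => IsEdgeArc (signatureMap γ) E p.1 p.2) (wordPow w m) I)
    (hsum : ∑ᶠ E, (multiplicity (wordPow w m) E : ℝ) * ω E = 2 * Real.pi * ξ)
    {κW : ℝ → ℝ} (hκW : κW = reshuffle (curvature γ) I)
    {γW : ℝ → ℂ} (hγW : γW = curveOfCurvature κW) :
    IsClosedCurve γW (totalLength I) ∧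
    (∀ s, curvature γW s = κW s) ∧
    HasTurningNumber γW (totalLength I) ξ ∧
    paramSymIndex γW = m ∧
    paramSigIndex γW (totalLength I) =
      ⨅ E ∈ wordPow w m, (multiplicity (wordPow w m) E : ℕ∞) ∧
    (IsSimple (range γW) → symIndex γW = m ∧
      sigIndex γW = ⨅ E ∈ wordPow w m, (multiplicity (wordPow w m) E : ℕ∞)) := by
  have hspeed : IsUnitSpeed γ := ⟨hγ.of_le (by norm_num), hunit⟩
  have hκ : ContDiff ℝ 1 (curvature γ) :=
    contDiff_curvature (n := 1) (hγ.of_le (by norm_num)) hspeed.deriv_ne_zero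
  have hrigid := hnd.isRigid_signatureMap hspeed hκ
  have hσ : ∀ s, HasDerivAt (curvature γ) (curvatureDot γ s) s := fun s =>
    hspeed.curvatureDot_eq ▸ (hκ.differentiable_one s).hasDerivAt
  have hangle : tangentAngle κW (totalLength I) = 2 * Real.pi * ξ :=
    hκW ▸ (hW.intervalIntegral_reshuffle hrigid hI hω).trans hsum
  have hsymm : IsSymmetricCurvature κW (breakpoint I w.length) m :=
    hκW ▸ hW.isSymmetricCurvature_reshuffle hrigid hσ hw hm hI hgcd (hκW ▸ hangle)
  have hcurvature : curvature γW = κW := hγW ▸ curvature_curveOfCurvature hsymm.continuous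
  have hclosed : IsClosedCurve γW (totalLength I) := by
    rw [hγW, hW.totalLength_wordPow hrigid hI]
    exact hsymm.isClosedCurve (hκW ▸ hW.contDiff_reshuffle hrigid hσ hI)
  have hsym : paramSymIndex γW = m := hγW ▸ hsymm.paramSymIndex_eq
  have hsig : paramSigIndex γW (totalLength I) =
      ⨅ E ∈ wordPow w m, (multiplicity (wordPow w m) E : ℕ∞) := by
    rw [paramSigIndex, hclosed.isUnitSpeed.signatureMap_eq, hcurvature]
    exact hW.iInf_encard_reshuffle hrigid hσ hI hκW
  exact ⟨hclosed, congrFun hcurvature,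
    hγW ▸ hasTurningNumber_curveOfCurvature hsymm.continuous hangle, hsym, hsig,
    fun hsimple => ⟨(hclosed.isUnitSpeed.symIndex_eq hsimple).trans hsym,
      (hclosed.sigIndex_eq hsimple).trans hsig⟩⟩

theorem mainTheorem7
    (γ : ℝ → ℂ) (L : ℝ) (hγ : IsClosedCurve γ L) (hnd : IsNondegenerate γ)
    (ξ : ℤ) (hξ : HasTurningNumber γ L ξ)
    (hQ : (selfIntersections (Set.range (signatureMap γ))).Nonempty)
    (hQfin : (selfIntersections (Set.range (signatureMap γ))).Finite)
    (ω : QuiverEdge (Set.range (signatureMap γ)) → ℝ) (hω : ∀ E, IsWeight γ E (ω E))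
    (w W : List (QuiverEdge (Set.range (signatureMap γ)))) (m : ℕ)
    (hw : ¬ IsPeriodicWord w) (hm : 1 < m) (hWw : W = wordPow w m)
    (hW : IsClosedPath (signatureMap γ) W)
    (hgcd : IsCoprime (m : ℤ) ξ)
    (I : List (ℝ × ℝ))
    (hI : List.Forall₂ (fun E p => IsEdgeArc (signatureMap γ) E p.1 p.2) W I)
    (hsum : ∑ᶠ E, (multiplicity W E : ℝ) * ω E = 2 * Real.pi * ξ)
    (κW : ℝ → ℝ) (hκW : κW = reshuffle (curvature γ) I)
    (γW : ℝ → ℂ) (hγW : γW = curveOfCurvature κW) :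
    IsClosedCurve γW (totalLength I) ∧
    (∀ s, curvature γW s = κW s) ∧
    HasTurningNumber γW (totalLength I) ξ ∧
    paramSymIndex γW = m ∧
    paramSigIndex γW (totalLength I) = ⨅ E ∈ W, (multiplicity W E : ℕ∞) ∧
    (IsSimple (Set.range γW) →
      symIndex γW = m ∧ sigIndex γW = ⨅ E ∈ W, (multiplicity W E : ℕ∞)) := by
  subst hWw
  exact mainTheorem7_general hγ.contDiff hγ.unit_speed hnd hω hw hm hW hgcd hI hsum hκW hγW
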